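/- **Setting.** A signature with $N$ parts is $\lambda=(\lambda_1\ge\dots\ge\lambda_N\ge 0)$ with integer entries; put $\mathcal S(\lambda)=\{\lambda_j+N-j+1: 1\le j\le N\}\subset\mathbb Z_{\ge1}$ and $0^N=(0,\dots,0)$. A six vertex configuration on $\mathbb Z_{\ge1}\times\{1,\dots,k\}$ assigns $0$ or $1$ to every edge so that $i_1+j_1=i_2+j_2$ at every vertex, where $i_1,j_1,i_2,j_2$ are the values on its bottom, left, top and right edges. For complex $x,y,r,s$ the vertex weights $W(i_1,j_1;i_2,j_2\mid x;y;r;s)$ are $$W(0,0;0,0)=1,\quad W(1,1;1,1)=\frac{r^{-2}x-y}{s^{-2}y-x},\quad W(1,0;1,0)=\frac{s^{-2}y-r^{-2}x}{s^{-2}y-x},$$ $$W(0,1;0,1)=\frac{y-x}{s^{-2}y-x},\quad W(1,0;0,1)=\frac{x(r^{-2}-1)}{s^{-2}y-x},\quad W(0,1;1,0)=\frac{y(s^{-2}-1)}{s^{-2}y-x},$$ and $\widehat W=W/W(0,1;0,1)$ (so $\widehat W(0,1;0,1)=1$ and the other five weights have denominator $y-x$). A partition function is the sum, over all configurations with the given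 boundary values, of the product of the vertex weights; the vertex in column $i$ and row $j$ (rows are numbered from bottom to top) has parameters $x_j,y_i,r_j,s_i$. * $F_\lambda(x_1,\dots,x_N;\mathbf y;\mathbf r;\mathbf s)$ is the partition function with $N$ rows and weights $\widehat W$, where the bottom boundary is occupied exactly at $\mathcal S(\lambda)$, the left and top boundaries are empty, and every row is occupied far to the right. * $G_\lambda(x_1,\dots,x_M;\mathbf y;\mathbf r;\mathbf s)$, for $\lambda$ with $N$ parts, is the partition function with $M$ rows and weights $W$, where the bottom boundary is occupied exactly at $\mathcal S(0^N)=\{1,\dots,N\}$, the top boundary exactly at $\mathcal S(\lambda)$, the left boundary is empty and every row is empty far to the right. The Schur polynomial is $s_\lambda(t_1,\dots,t_N)=\det[t_i^{\lambda_j+N-j}]/\prod_{i<j}(t_i-t_j)$. The supersymmetric Schur functions $s_\lambda(\mathbf a/\mathbf b)$, $\mathbf a=(a_1,\dots,a_M)$, $\mathbf b=(b_1,\dots,b_M)$, are the coefficients in the identity of formal power series in $t_1,\dots,t_N$ $$\sum_{\lambda=(\lambda_1\ge\dots\ge\lambda_N\ge0)}s_\lambda(\mathbf a/\mathbf b)\,s_\lambda(t_1,\dots,t_N)=\prod_{i=1}^N\prod_{j=1}^M\frac{1+t_ib_j}{1-t_ia_j}.$$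 **Proposition 4.5.** Let $\lambda$ be a signature with $N$ parts, and let $y_j=1$, $s_j=s\ne0$ for all $j\ge1$. All $r_i$ are nonzero complex numbers. (1) If $x_1,\dots,x_N\in\mathbb C\setminus\{1\}$ are pairwise distinct, then $$F_\lambda(x_1,\dots,x_N;1;\mathbf r;s)=\det\left[\left(\frac{1-s^2x_i}{s^2(1-x_i)}\right)^{\lambda_j+N-j}\right]_{i,j=1}^N\prod_{i=1}^N\frac{(r_i^{-2}-1)x_i}{1-x_i}\prod_{1\le i<j\le N}\frac{r_i^{-2}x_i-x_j}{x_i-x_j}.$$ (2) If $x_1,\dots,x_N\in\mathbb C\setminus\{1\}$ and $F_{0^N}(x_1,\dots,x_N;1;\mathbf r;s)\ne0$, then $$\frac{F_\lambda(x_1,\dots,x_N;1;\mathbf r;s)}{F_{0^N}(x_1,\dots,x_N;1;\mathbf r;s)}=s_\lambda\left(\frac{1-s^2x_1}{s^2(1-x_1)},\dots,\frac{1-s^2x_N}{s^2(1-x_N)}\right).$$ (3) For every $M$ and all $x_1,\dots,x_M\in\mathbb C$ with $s^2x_j\ne1$ and $s^2r_j^{-2}x_j\ne1$ for all $j$, $$G_\lambda(x_1,\dots,x_M;1;\mathbf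 r;s)=s_\lambda\left(\left\{\frac{s^2(1-x_j)}{1-s^2x_j}\right\}_{j=1}^M\Big/\left\{\frac{s^2(x_jr_j^{-2}-1)}{1-s^2r_j^{-2}x_j}\right\}_{j=1}^M\right)\prod_{i=1}^M\left(\frac{1-s^2r_i^{-2}x_i}{1-s^2x_i}\right)^N.$$ -/

import Mathlib

namespace FreeFermion

open Filter
open scoped MvPowerSeries.WithPiTopology

/-! ### Signatures -/

/-- A (nonnegative) signature with `N` parts: integers `λ₁ ≥ … ≥ λ_N ≥ 0`
(the part `λ_{j+1}` is `parts j`). -/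
@[ext]
structure Signature (N : ℕ) where
  parts : Fin N → ℕ
  anti : Antitone parts

namespace Signature

variable {N : ℕ}

/-- The signature `0^N = (0, …, 0)`. -/
def zero (N : ℕ) : Signature N := ⟨fun _ => 0, fun _ _ _ => le_rfl⟩

/-- The strictly decreasing sequence `λ_j + N - j` (`j = 1, …, N`). -/
def shifted (l : Signature N) (j : Fin N) : ℕ := l.parts j + (N - 1 - (j : ℕ))

/-- The point configuration `S(λ) = {λ_j + N - j + 1 : j = 1, …, N} ⊂ ℤ_{≥ 1}` of a signature.
Columns are numbered from `0` here: the column `c : ℕ` is the lattice column `c + 1`. -/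
def points (l : Signature N) : Set ℕ := Set.range l.shifted

/-- The signature with `N + 1` parts obtained by appending a zero part. -/
def snocZero (l : Signature N) : Signature (N + 1) where
  parts := Fin.snoc (α := fun _ => ℕ) l.parts 0
  anti := by
    intro i j hij
    induction j using Fin.lastCases with
    | last => simp
    | cast j =>
      induction i using Fin.lastCases with
      | last => exact absurd hij (by simp [Fin.le_def])
      | cast i => simpa using l.anti (by simpa using hij)

end Signature

/-! ### The six vertex model -/

/-- The vertex weights `W(i₁, j₁; i₂, j₂ | x; y; r; s)`: `i₁`, `j₁`, `i₂`, `j₂` are the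
occupations of the bottom, left, top and right edge of the vertex. -/
noncomputable def weightW (x y r s : ℂ) : Bool → Bool → Bool → Bool → ℂ
  | false, false, false, false => 1
  | true, true, true, true => (r ^ (-2 : ℤ) * x - y) / (s ^ (-2 : ℤ) * y - x)
  | true, false, true, false => (s ^ (-2 : ℤ) * y - r ^ (-2 : ℤ) * x) / (s ^ (-2 : ℤ) * y - x)
  | false, true, false, true => (y - x) / (s ^ (-2 : ℤ) * y - x)
  | true, false, false, true => x * (r ^ (-2 : ℤ) - 1) / (s ^ (-2 : ℤ) * y - x)
  | false, true, true, false => y * (s ^ (-2 : ℤ) - 1) / (s ^ (-2 : ℤ) * y - x)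
  | _, _, _, _ => 0

/-- The vertex weights `Ŵ(i₁, j₁; i₂, j₂ | x; y; r; s)`. -/
noncomputable def weightWHat (x y r s : ℂ) : Bool → Bool → Bool → Bool → ℂ
  | false, false, false, false => (s ^ (-2 : ℤ) * y - x) / (y - x)
  | true, true, true, true => (r ^ (-2 : ℤ) * x - y) / (y - x)
  | true, false, true, false => (s ^ (-2 : ℤ) * y - r ^ (-2 : ℤ) * x) / (y - x)
  | false, true, false, true => 1
  | true, false, false, true => x * (r ^ (-2 : ℤ) - 1) / (y - x)
  | false, true, true, false => y * (s ^ (-2 : ℤ) - 1) / (y - x)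
  | _, _, _, _ => 0

/-- An assignment of occupation numbers to the edges of the half-infinite rectangle with `k` rows
(numbered from bottom to top) and columns `0, 1, 2, …`. The vertex in column `c` and row `j` has
bottom edge `vert j.castSucc c`, top edge `vert j.succ c`, left edge `horiz j c` and right edge
`horiz j (c + 1)`. -/
structure Configuration (k : ℕ) where
  vert : Fin (k + 1) → ℕ → Bool
  horiz : Fin k → ℕ → Bool

/-- Path configurations of the six vertex model: paths are preserved at every vertex, the bottom
and top boundary edges are occupied exactly at `bottom` and `top`, the left boundary is empty, and
far to the right each row has the state `right`. -/
structure Configuration.IsAdmissible {k : ℕ} (C : Configuration k) (bottom top : Set ℕ)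
    (right : Bool) : Prop where
  preserved : ∀ (j : Fin k) (c : ℕ),
    (C.vert j.castSucc c).toNat + (C.horiz j c).toNat =
      (C.vert j.succ c).toNat + (C.horiz j (c + 1)).toNat
  bottom_iff : ∀ c, C.vert 0 c = true ↔ c ∈ bottom
  top_iff : ∀ c, C.vert (Fin.last k) c = true ↔ c ∈ top
  left_empty : ∀ j, C.horiz j 0 = false
  right_eq : ∀ j, ∀ᶠ c in atTop, C.horiz j c = right

/-- The weight of a configuration: the product of the vertex weights over all vertices, where
`w c j` is the weight function at column `c` and row `j`. -/
noncomputable def Configuration.weight {k : ℕ} (w : ℕ → Fin k → Bool → Bool → Bool → Bool → ℂ)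
    (C : Configuration k) : ℂ :=
  ∏ᶠ p : ℕ × Fin k, w p.1 p.2 (C.vert p.2.castSucc p.1) (C.horiz p.2 p.1)
    (C.vert p.2.succ p.1) (C.horiz p.2 (p.1 + 1))

/-- The partition function: the sum of the weights of all admissible configurations (for the
boundary conditions below there are finitely many of them, and in each one all but finitely many
vertices have weight `1`). -/
noncomputable def partitionFunction {k : ℕ} (w : ℕ → Fin k → Bool → Bool → Bool → Bool → ℂ)
    (bottom top : Set ℕ) (right : Bool) : ℂ :=
  ∑ᶠ C ∈ {C : Configuration k | C.IsAdmissible bottom top right}, C.weight w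

/-- `F_λ(x₁, …, x_N; y; r₁, …, r_N; s)`: weights `Ŵ`, paths enter from the bottom at `S(λ)` and
exit to the right, one in each row; the left and the top boundaries are empty.
(`y c`, `s c` are the parameters of the column `c`.) -/
noncomputable def F {N : ℕ} (l : Signature N) (x : Fin N → ℂ) (y : ℕ → ℂ) (r : Fin N → ℂ)
    (s : ℕ → ℂ) : ℂ :=
  partitionFunction (fun c j => weightWHat (x j) (y c) (r j) (s c)) l.points ∅ true

/-- `G_λ(x₁, …, x_M; y; r₁, …, r_M; s)`: weights `W`, paths enter from the bottom at `S(0^N)` and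
exit at the top at `S(λ)`; the left and the right boundaries are empty. -/
noncomputable def G {N M : ℕ} (l : Signature N) (x : Fin M → ℂ) (y : ℕ → ℂ) (r : Fin M → ℂ)
    (s : ℕ → ℂ) : ℂ :=
  partitionFunction (fun c j => weightW (x j) (y c) (r j) (s c)) (Signature.zero N).points
    l.points false

/-! ### Schur polynomials -/

/-- The alternant `det [t_i ^ (λ_j + N - j)]`. -/
noncomputable def alternant {N : ℕ} {R : Type*} [CommRing R] (l : Signature N) (t : Fin N → R) :
    R :=
  (Matrix.of fun i j : Fin N => t i ^ l.shifted j).det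

theorem alternant_zero_dvd {N : ℕ} {R : Type*} [CommRing R] (l : Signature N) (t : Fin N → R) :
    alternant (Signature.zero N) t ∣ alternant l t := by
  nontriviality R
  let q : Polynomial R := ∏ i, (Polynomial.X - Polynomial.C (t i))
  have hq : q.Monic := Polynomial.monic_prod_of_monic _ _ fun i _ => Polynomial.monic_X_sub_C _
  have hqd : q.natDegree = N := by
    simp [q, Polynomial.natDegree_finsetProd_X_sub_C_eq_card]
  let p : Fin N → Polynomial R := fun j => (Polynomial.X ^ l.shifted j) %ₘ q
  have hM : (Matrix.of fun i j : Fin N => t i ^ l.shifted j) =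
      (Matrix.of fun i j : Fin N => t i ^ (Signature.zero N).shifted j) *
        (Matrix.of fun k j : Fin N => (p j).coeff (Fin.rev k)) := by
    ext i j
    have hN : 0 < N := i.pos
    have hpd : (p j).natDegree < N := by
      rw [← hqd]
      refine Polynomial.natDegree_modByMonic_lt _ hq ?_
      intro h
      rw [h] at hqd
      simp at hqd
      omega
    have hev : (p j).eval (t i) = t i ^ l.shifted j := by
      have h0 : q.eval (t i) = 0 := by
        simp only [q, Polynomial.eval_prod]
        exact Finset.prod_eq_zero (Finset.mem_univ i) (by simp)
      have := Polynomial.modByMonic_add_div (Polynomial.X ^ l.shifted j) q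
      have h2 := congrArg (Polynomial.eval (t i)) this
      simpa [h0] using h2
    rw [Matrix.mul_apply]
    simp only [Matrix.of_apply]
    rw [← hev, Polynomial.eval_eq_sum_range' hpd, ← Fin.sum_univ_eq_sum_range
      (fun k => (p j).coeff k * t i ^ k), ← Equiv.sum_comp Fin.revPerm]
    refine Finset.sum_congr rfl fun k _ => ?_
    have : (Signature.zero N).shifted k = (Fin.rev k : ℕ) := by
      simp [Signature.shifted, Signature.zero, Fin.val_rev]
      omega
    rw [this, mul_comm]
    rfl
  unfold alternant
  rw [hM, Matrix.det_mul]
  exact Dvd.intro _ rfl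

/-- The Schur polynomial `s_λ(t₁, …, t_N)`: the quotient of the alternant
`det [t_i ^ (λ_j + N - j)]` by `det [t_i ^ (N - j)] = ∏_{i < j} (t_i - t_j)`, as a polynomial. -/
noncomputable def schur {N : ℕ} (l : Signature N) : MvPolynomial (Fin N) ℂ :=
  (alternant_zero_dvd l (MvPolynomial.X (R := ℂ))).choose

theorem alternant_zero_mul_schur {N : ℕ} (l : Signature N) :
    alternant (Signature.zero N) MvPolynomial.X * schur l = alternant l MvPolynomial.X :=
  (alternant_zero_dvd l (MvPolynomial.X (R := ℂ))).choose_spec.symm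

/-! ### Supersymmetric Schur functions -/

/-- `∏_{i=1}^N ∏_{j=1}^M (1 + t_i b_j) / (1 - t_i a_j)` as a formal power series in
`t₁, …, t_N`. -/
noncomputable def cauchyKernel (N : ℕ) {M : ℕ} (a b : Fin M → ℂ) : MvPowerSeries (Fin N) ℂ :=
  ∏ i : Fin N, ∏ j : Fin M,
    (1 + MvPowerSeries.X i * MvPowerSeries.C (b j)) *
      (1 - MvPowerSeries.X i * MvPowerSeries.C (a j))⁻¹

/-- The Cauchy identity `∑_λ S_λ s_λ(t₁, …, t_N) = ∏_i ∏_j (1 + t_i b_j) / (1 - t_i a_j)` for a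
family of numbers `S_λ`, the sum being over all signatures with `N` parts; it is an identity of
formal power series in `t₁, …, t_N` (each coefficient on the left is a finite sum). -/
def CauchyIdentity {N M : ℕ} (a b : Fin M → ℂ) (S : Signature N → ℂ) : Prop :=
  HasSum (fun l : Signature N => S l • (schur l : MvPowerSeries (Fin N) ℂ)) (cauchyKernel N a b)

section CauchyUniqueness

variable {N : ℕ}

namespace Signature

theorem shifted_strictAnti (l : Signature N) : StrictAnti l.shifted := by
  intro i j hij
  have := l.anti hij.le
  simp only [shifted]
  have h1 : (i : ℕ) < j := hij
  have h2 := j.isLt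
  omega

theorem ext_shifted {l m : Signature N} (h : l.shifted = m.shifted) : l = m := by
  ext j
  have := congrFun h j
  simp only [shifted] at this
  omega

/-- The exponent `λ + δ` of the leading monomial of the alternant. -/
noncomputable def exponent (l : Signature N) : Fin N →₀ ℕ := Finsupp.equivFunOnFinite.symm l.shifted

theorem eq_of_mapDomain {l m : Signature N} {σ : Equiv.Perm (Fin N)}
    (h : l.exponent.mapDomain σ = m.exponent) : l = m ∧ σ = 1 := by
  have h1 : ∀ i, l.shifted i = m.shifted (σ i) := fun i => by
    have := DFunLike.congr_fun h (σ i)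
    rw [Finsupp.mapDomain_apply σ.injective] at this
    exact this
  have hm : StrictMono σ := fun i j hij => by
    have := l.shifted_strictAnti hij
    rw [h1, h1] at this
    exact m.shifted_strictAnti.lt_iff_gt.1 this
  have hσ : σ = 1 := by
    have : (σ : Fin N → Fin N) = id :=
      StrictMono.range_inj hm strictMono_id |>.1 (by simp [σ.surjective.range_eq])
    exact Equiv.ext fun i => congrFun this i
  subst hσ
  exact ⟨ext_shifted (funext fun i => by simpa using h1 i), rfl⟩

theorem exists_mapDomain (d : Fin N →₀ ℕ) (hd : Function.Injective d) :
    ∃ (l : Signature N) (σ : Equiv.Perm (Fin N)), l.exponent.mapDomain σ = d := by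
  let σ : Equiv.Perm (Fin N) := Fin.revPerm.trans (Tuple.sort d)
  have hg : StrictAnti (d ∘ σ) := by
    have h1 : StrictMono (d ∘ Tuple.sort d) :=
      (Tuple.monotone_sort d).strictMono_of_injective (hd.comp (Equiv.injective _))
    intro i j hij
    exact h1 (Fin.rev_lt_rev.2 hij)
  have hstep : ∀ (i j : Fin N), i ≤ j → (d ∘ σ) j + (j - i : ℕ) ≤ (d ∘ σ) i := by
    intro i j hij
    obtain ⟨i, hi⟩ := i
    obtain ⟨j, hj⟩ := j
    simp only [Fin.mk_le_mk] at hij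
    induction j, hij using Nat.le_induction with
    | base => simp
    | succ k hk ih =>
      have h1 := ih (by omega)
      have h2 : (d ∘ σ) ⟨k + 1, hj⟩ < (d ∘ σ) ⟨k, by omega⟩ := hg (by simp)
      simp only at h1 ⊢
      omega
  let l : Signature N :=
    { parts := fun j => (d ∘ σ) j - (N - 1 - (j : ℕ))
      anti := by
        intro i j hij
        have h1 := hstep i j hij
        have h2 : (i : ℕ) ≤ j := hij
        have h3 := j.isLt
        have h4 := hstep j ⟨N - 1, by omega⟩ (by simp [Fin.le_def]; omega)
        simp only at h4 ⊢
        omega }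
  refine ⟨l, σ, ?_⟩
  ext i
  obtain ⟨i, rfl⟩ := σ.surjective i
  rw [Finsupp.mapDomain_apply σ.injective]
  change (d ∘ σ) i - (N - 1 - (i : ℕ)) + (N - 1 - (i : ℕ)) = (d ∘ σ) i
  have h3 := i.isLt
  have h4 := hstep i ⟨N - 1, by omega⟩ (by simp [Fin.le_def]; omega)
  simp only at h4
  omega

end Signature

theorem alternant_eq_sum (l : Signature N) :
    alternant l (MvPowerSeries.X (R := ℂ)) =
      ∑ σ : Equiv.Perm (Fin N), MvPowerSeries.monomial (l.exponent.mapDomain σ)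
        (((Equiv.Perm.sign σ : ℤ) : ℂ)) := by
  unfold alternant
  rw [Matrix.det_apply]
  refine Finset.sum_congr rfl fun σ _ => ?_
  have h1 : l.exponent.mapDomain σ = ∑ i, Finsupp.single (σ i) (l.shifted i) := by
    conv_lhs => rw [← Finsupp.univ_sum_single l.exponent]
    rw [Finsupp.mapDomain_finsetSum]
    simp [Finsupp.mapDomain_single, Signature.exponent]
  have h2 : ∏ i, (MvPowerSeries.X (R := ℂ) (σ i)) ^ l.shifted i =
      MvPowerSeries.monomial (l.exponent.mapDomain σ) (1 : ℂ) := by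
    rw [h1]
    simp only [MvPowerSeries.X_pow_eq]
    rw [MvPowerSeries.prod_monomial]
    simp
  simp only [Matrix.of_apply]
  rw [h2, Units.smul_def, ← Int.cast_smul_eq_zsmul ℂ, ← map_smul]
  simp

theorem coeff_exponent_alternant [DecidableEq (Signature N)] (l m : Signature N) :
    MvPowerSeries.coeff m.exponent (alternant l (MvPowerSeries.X (R := ℂ))) =
      if l = m then 1 else 0 := by
  classical
  rw [alternant_eq_sum, map_sum]
  simp only [MvPowerSeries.coeff_monomial]
  rw [Finset.sum_eq_single 1]
  · have : (l.exponent.mapDomain (1 : Equiv.Perm (Fin N)) : Fin N →₀ ℕ) = l.exponent :=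
      Finsupp.mapDomain_id
    rw [this]
    split_ifs with h1 h2 h2
    · simp
    · refine absurd (Signature.ext_shifted ?_) h2
      exact (Finsupp.equivFunOnFinite.symm.injective h1).symm
    · exact absurd (by rw [h2]) h1
    · rfl
  · intro σ _ hσ
    rw [if_neg]
    intro h
    exact hσ (Signature.eq_of_mapDomain h.symm).2
  · simp

theorem exists_of_coeff_alternant_ne {l : Signature N} {d : Fin N →₀ ℕ}
    (h : MvPowerSeries.coeff d (alternant l (MvPowerSeries.X (R := ℂ))) ≠ 0) :
    ∃ σ : Equiv.Perm (Fin N), l.exponent.mapDomain σ = d := by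
  classical
  rw [alternant_eq_sum, map_sum] at h
  obtain ⟨σ, _, hσ⟩ := Finset.exists_ne_zero_of_sum_ne_zero h
  refine ⟨σ, ?_⟩
  rw [MvPowerSeries.coeff_monomial] at hσ
  by_contra h'
  exact hσ (if_neg fun h'' => h' h''.symm)

theorem coe_alternant (l : Signature N) :
    ((alternant l (MvPolynomial.X (R := ℂ)) : MvPolynomial (Fin N) ℂ) : MvPowerSeries (Fin N) ℂ) =
      alternant l MvPowerSeries.X := by
  unfold alternant
  have := RingHom.map_det (MvPolynomial.coeToMvPowerSeries.ringHom (σ := Fin N) (R := ℂ))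
    (Matrix.of fun i j : Fin N => (MvPolynomial.X i) ^ l.shifted j)
  refine this.trans (congrArg Matrix.det ?_)
  ext i j : 2
  simp

theorem alternant_zero_mul_coe_schur (l : Signature N) :
    alternant (Signature.zero N) MvPowerSeries.X * (schur l : MvPowerSeries (Fin N) ℂ) =
      alternant l MvPowerSeries.X := by
  rw [← coe_alternant, ← coe_alternant, ← alternant_zero_mul_schur l, MvPolynomial.coe_mul]

theorem alternant_zero_ne_zero : alternant (Signature.zero N) (MvPowerSeries.X (R := ℂ)) ≠ 0 := by
  classical
  intro h
  have := coeff_exponent_alternant (Signature.zero N) (Signature.zero N)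
  rw [h] at this
  simp at this

/-- Uniqueness in the Cauchy identity, with an explicit formula for the coefficients. -/
theorem CauchyIdentity.eq_coeff {M : ℕ} {a b : Fin M → ℂ} {S : Signature N → ℂ}
    (h : CauchyIdentity a b S) (l : Signature N) :
    S l = MvPowerSeries.coeff l.exponent
      (alternant (Signature.zero N) MvPowerSeries.X * cauchyKernel N a b) := by
  classical
  have h1 := HasSum.mul_left (alternant (Signature.zero N) (MvPowerSeries.X (R := ℂ))) h
  simp only [mul_smul_comm, alternant_zero_mul_coe_schur] at h1
  have h2 := MvPowerSeries.WithPiTopology.hasSum_iff_hasSum_coeff.1 h1 l.exponent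
  refine HasSum.unique ?_ h2
  have h3 : (fun m : Signature N => MvPowerSeries.coeff l.exponent
      (S m • alternant m (MvPowerSeries.X (R := ℂ)))) = fun m => if m = l then S l else 0 := by
    ext m
    rw [map_smul, coeff_exponent_alternant]
    split_ifs with h <;> simp [h]
  rw [h3]
  exact hasSum_ite_eq l (S l)

theorem rename_alternant_zero (σ : Equiv.Perm (Fin N)) :
    MvPowerSeries.rename σ (alternant (Signature.zero N) (MvPowerSeries.X (R := ℂ))) =
      ((Equiv.Perm.sign σ : ℤ) : MvPowerSeries (Fin N) ℂ) *
        alternant (Signature.zero N) MvPowerSeries.X := by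
  unfold alternant
  rw [← Matrix.det_permute, AlgHom.map_det]
  congr 1
  ext i j : 2
  simp

theorem rename_cauchyKernel {M : ℕ} (a b : Fin M → ℂ) (σ : Equiv.Perm (Fin N)) :
    MvPowerSeries.rename σ (cauchyKernel N a b) = cauchyKernel N a b := by
  unfold cauchyKernel
  rw [map_prod]
  refine Eq.trans ?_ (Equiv.prod_comp σ _)
  refine Finset.prod_congr rfl fun i _ => ?_
  rw [map_prod]
  refine Finset.prod_congr rfl fun j _ => ?_
  rw [map_mul]
  congr 1
  · simp
  · rw [MvPowerSeries.eq_inv_iff_mul_eq_one (by simp)]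
    have : (1 - MvPowerSeries.X (σ i) * MvPowerSeries.C (a j) : MvPowerSeries (Fin N) ℂ) =
        MvPowerSeries.rename σ (1 - MvPowerSeries.X i * MvPowerSeries.C (a j)) := by simp
    rw [this, ← map_mul, MvPowerSeries.inv_mul_cancel _ (by simp), map_one]

theorem coeff_mapDomain_of_alternating {f : MvPowerSeries (Fin N) ℂ} {σ : Equiv.Perm (Fin N)}
    (hf : MvPowerSeries.rename σ f = ((Equiv.Perm.sign σ : ℤ) : MvPowerSeries (Fin N) ℂ) * f)
    (d : Fin N →₀ ℕ) :
    MvPowerSeries.coeff d f =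
      ((Equiv.Perm.sign σ : ℤ) : ℂ) * MvPowerSeries.coeff (d.mapDomain σ) f := by
  have h1 := MvPowerSeries.coeff_embDomain_rename σ.toEmbedding f d
  rw [Finsupp.embDomain_eq_mapDomain] at h1
  have h2 : MvPowerSeries.coeff (d.mapDomain σ) (MvPowerSeries.rename σ f) =
    MvPowerSeries.coeff d f := h1
  rw [← h2, hf, ← zsmul_eq_mul, map_zsmul, zsmul_eq_mul]

theorem hasSum_alternant_of_alternating (f : MvPowerSeries (Fin N) ℂ)
    (hf : ∀ σ : Equiv.Perm (Fin N), MvPowerSeries.rename σ f =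
      ((Equiv.Perm.sign σ : ℤ) : MvPowerSeries (Fin N) ℂ) * f) :
    HasSum (fun l : Signature N => MvPowerSeries.coeff l.exponent f •
      alternant l (MvPowerSeries.X (R := ℂ))) f := by
  classical
  rw [MvPowerSeries.WithPiTopology.hasSum_iff_hasSum_coeff]
  intro d
  simp only [map_smul, smul_eq_mul]
  by_cases hd : Function.Injective d
  · obtain ⟨l, σ, rfl⟩ := Signature.exists_mapDomain d hd
    have key : ∀ τ : Equiv.Perm (Fin N), ∀ m : Signature N,
        m.exponent.mapDomain τ = l.exponent.mapDomain σ → m = l ∧ τ = σ := by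
      intro τ m h
      have h1 : m.exponent.mapDomain (σ⁻¹ * τ : Equiv.Perm (Fin N)) = l.exponent := by
        rw [Equiv.Perm.coe_mul, Finsupp.mapDomain_comp, h, ← Finsupp.mapDomain_comp,
          ← Equiv.Perm.coe_mul, inv_mul_cancel]
        exact Finsupp.mapDomain_id
      obtain ⟨h2, h3⟩ := Signature.eq_of_mapDomain h1
      exact ⟨h2, (inv_mul_eq_one.1 h3).symm⟩
    have h1 : MvPowerSeries.coeff (l.exponent.mapDomain σ)
        (alternant l (MvPowerSeries.X (R := ℂ))) = ((Equiv.Perm.sign σ : ℤ) : ℂ) := by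
      rw [alternant_eq_sum, map_sum, Finset.sum_eq_single σ]
      · simp
      · intro τ _ hτ
        rw [MvPowerSeries.coeff_monomial, if_neg]
        intro h
        exact hτ (key τ l h.symm).2
      · simp
    have h2 := coeff_mapDomain_of_alternating (hf σ) l.exponent
    have h3 : MvPowerSeries.coeff (l.exponent.mapDomain σ) f =
        MvPowerSeries.coeff l.exponent f * MvPowerSeries.coeff (l.exponent.mapDomain σ)
          (alternant l (MvPowerSeries.X (R := ℂ))) := by
      rw [h1, h2]
      rcases Int.units_eq_one_or (Equiv.Perm.sign σ) with h | h <;> simp [h]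
    rw [h3]
    refine hasSum_single l fun m hm => ?_
    by_contra h
    obtain ⟨τ, hτ⟩ := exists_of_coeff_alternant_ne (right_ne_zero_of_mul h)
    exact hm (key τ m hτ).1
  · have h0 : ∀ l : Signature N,
        MvPowerSeries.coeff d (alternant l (MvPowerSeries.X (R := ℂ))) = 0 := by
      intro l
      by_contra h
      obtain ⟨σ, rfl⟩ := exists_of_coeff_alternant_ne h
      apply hd
      intro i j hij
      obtain ⟨i, rfl⟩ := σ.surjective i
      obtain ⟨j, rfl⟩ := σ.surjective j
      rw [Finsupp.mapDomain_apply σ.injective, Finsupp.mapDomain_apply σ.injective] at hij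
      rw [l.shifted_strictAnti.injective hij]
    have h1 : MvPowerSeries.coeff d f = 0 := by
      simp only [Function.Injective, not_forall] at hd
      obtain ⟨i, j, hij, hne⟩ := hd
      have h2 := coeff_mapDomain_of_alternating (hf (Equiv.swap i j)) d
      have h3 : d.mapDomain (Equiv.swap i j) = d := by
        ext k
        obtain ⟨k, rfl⟩ := (Equiv.swap i j).surjective k
        rw [Finsupp.mapDomain_apply (Equiv.injective _)]
        rcases eq_or_ne k i with rfl | hki
        · simp [hij]
        rcases eq_or_ne k j with rfl | hkj
        · simp [hij]
        rw [Equiv.swap_apply_of_ne_of_ne hki hkj]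
      rw [h3, Equiv.Perm.sign_swap hne] at h2
      simp only [Units.val_neg, Units.val_one, Int.cast_neg, Int.cast_one, neg_one_mul] at h2
      exact self_eq_neg.1 h2
    simp only [h0, h1, mul_zero]
    exact hasSum_zero

theorem summable_smul_schur (S : Signature N → ℂ) :
    Summable fun l : Signature N => S l • (schur l : MvPowerSeries (Fin N) ℂ) := by
  rw [MvPowerSeries.WithPiTopology.summable_iff_summable_coeff]
  intro d
  obtain ⟨K, hK⟩ : ∃ K : ℕ, (alternant (Signature.zero N) (MvPowerSeries.X (R := ℂ))).order = K :=
    ENat.ne_top_iff_exists.1 (by simpa using alternant_zero_ne_zero) |>.imp fun _ h => h.symm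
  refine summable_of_hasFiniteSupport (Set.Finite.subset
    (s := {l : Signature N | ∀ j, l.parts j ≤ K + d.degree}) ?_ ?_)
  · have h : {g : Fin N → ℕ | ∀ j, g j ∈ Set.Iic (K + d.degree)}.Finite :=
      Set.Finite.pi' fun _ => Set.finite_Iic _
    refine (h.preimage (f := Signature.parts) ?_).subset ?_
    · intro l _ m _ hlm
      exact Signature.ext hlm
    · intro l hl
      exact hl
  · intro l hl j
    have h1 : MvPowerSeries.coeff d (schur l : MvPowerSeries (Fin N) ℂ) ≠ 0 := by
      intro h
      apply hl
      simp only [map_smul, h, smul_zero]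
    have h2 := MvPowerSeries.order_le h1
    have h3 : ((l.exponent.degree : ℕ) : ℕ∞) ≤
        (alternant l (MvPowerSeries.X (R := ℂ))).order := by
      apply MvPowerSeries.le_order
      intro e he
      by_contra h
      obtain ⟨σ, rfl⟩ := exists_of_coeff_alternant_ne h
      rw [Finsupp.degree_mapDomain] at he
      exact lt_irrefl _ he
    rw [← alternant_zero_mul_coe_schur, MvPowerSeries.order_mul, hK] at h3
    have h4 : ((l.exponent.degree : ℕ) : ℕ∞) ≤ ((K + d.degree : ℕ) : ℕ∞) := by
      push_cast
      exact h3.trans (by gcongr)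
    have h5 : l.exponent.degree ≤ K + d.degree := by exact_mod_cast h4
    have h6 : l.exponent j ≤ l.exponent.degree := Finsupp.le_degree j l.exponent
    have h7 : l.exponent j = l.parts j + (N - 1 - (j : ℕ)) := rfl
    omega

/-- The Cauchy identity determines its coefficients, and they exist. -/
theorem existsUnique_cauchyIdentity (N : ℕ) {M : ℕ} (a b : Fin M → ℂ) :
    ∃! S : Signature N → ℂ, CauchyIdentity a b S := by
  refine ⟨fun l => MvPowerSeries.coeff l.exponent
      (alternant (Signature.zero N) MvPowerSeries.X * cauchyKernel N a b), ?_, ?_⟩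
  · have h1 := hasSum_alternant_of_alternating
      (alternant (Signature.zero N) (MvPowerSeries.X (R := ℂ)) * cauchyKernel N a b) (by
        intro σ
        rw [map_mul, rename_alternant_zero, rename_cauchyKernel, mul_assoc])
    have h2 := (summable_smul_schur fun l : Signature N => MvPowerSeries.coeff l.exponent
      (alternant (Signature.zero N) (MvPowerSeries.X (R := ℂ)) * cauchyKernel N a b)).hasSum
    have h3 := HasSum.mul_left (alternant (Signature.zero N) (MvPowerSeries.X (R := ℂ))) h2
    simp only [mul_smul_comm, alternant_zero_mul_coe_schur] at h3
    have h4 := mul_left_cancel₀ alternant_zero_ne_zero (h3.unique h1)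
    rw [h4] at h2
    exact h2
  · intro S hS
    exact funext fun l => hS.eq_coeff l

end CauchyUniqueness

/-- The supersymmetric Schur function `s_λ(a₁, …, a_M / b₁, …, b_M)`: the coefficient of
`s_λ(t₁, …, t_N)` in the Cauchy identity, where `N` is the number of parts of `λ`. -/
noncomputable def supersymSchur {N M : ℕ} (l : Signature N) (a b : Fin M → ℂ) : ℂ :=
  (existsUnique_cauchyIdentity N a b).choose l

theorem cauchyIdentity_supersymSchur (N : ℕ) {M : ℕ} (a b : Fin M → ℂ) :
    CauchyIdentity a b (fun l : Signature N => supersymSchur l a b) :=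
  (existsUnique_cauchyIdentity N a b).choose_spec.1

/-- Appending a zero part to `λ` does not change the supersymmetric Schur function: in its
definition `N` can be any integer that is at least the number of nonzero parts of `λ`. -/
theorem supersymSchur_snocZero {N M : ℕ} (l : Signature N) (a b : Fin M → ℂ) :
    supersymSchur l.snocZero a b = supersymSchur l a b := by
  classical
  rw [(cauchyIdentity_supersymSchur (N + 1) a b).eq_coeff l.snocZero,
    (cauchyIdentity_supersymSchur N a b).eq_coeff l]
  let e : Fin N ↪ Fin (N + 1) := Fin.castSuccEmb
  have hX : ∀ i : Fin N, MvPowerSeries.killCompl e (MvPowerSeries.X (R := ℂ) i.castSucc) =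
      MvPowerSeries.X i := fun i => MvPowerSeries.killCompl_X (e := e) (R := ℂ) i
  have hX0 : MvPowerSeries.killCompl e (MvPowerSeries.X (R := ℂ) (Fin.last N)) = 0 := by
    apply MvPowerSeries.killCompl_X_eq_zero
    rintro ⟨i, hi⟩
    exact (Fin.castSucc_lt_last i).ne hi
  have hK : MvPowerSeries.killCompl e (cauchyKernel (N + 1) a b) = cauchyKernel N a b := by
    unfold cauchyKernel
    rw [Fin.prod_univ_castSucc, map_mul, map_prod, map_prod]
    have hlast : ∏ j : Fin M, MvPowerSeries.killCompl e
        ((1 + MvPowerSeries.X (Fin.last N) * MvPowerSeries.C (b j)) *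
          (1 - MvPowerSeries.X (Fin.last N) * MvPowerSeries.C (a j))⁻¹) = 1 := by
      refine Finset.prod_eq_one fun j _ => ?_
      rw [map_mul]
      have h1 : MvPowerSeries.killCompl e
          (1 + MvPowerSeries.X (Fin.last N) * MvPowerSeries.C (b j)) = 1 := by simp [hX0]
      have h2 : MvPowerSeries.killCompl e
          (1 - MvPowerSeries.X (Fin.last N) * MvPowerSeries.C (a j)) = 1 := by simp [hX0]
      rw [h1, one_mul]
      have h3 := congrArg (MvPowerSeries.killCompl e) (MvPowerSeries.mul_inv_cancel
        (1 - MvPowerSeries.X (Fin.last N) * MvPowerSeries.C (a j)) (by simp))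
      rwa [map_mul, h2, one_mul, map_one] at h3
    rw [hlast, mul_one]
    refine Finset.prod_congr rfl fun i _ => ?_
    rw [map_prod]
    refine Finset.prod_congr rfl fun j _ => ?_
    rw [map_mul]
    congr 1
    · simp [hX]
    · rw [MvPowerSeries.eq_inv_iff_mul_eq_one (by simp)]
      have : (1 - MvPowerSeries.X i * MvPowerSeries.C (a j) : MvPowerSeries (Fin N) ℂ) =
          MvPowerSeries.killCompl e
            (1 - MvPowerSeries.X i.castSucc * MvPowerSeries.C (a j)) := by simp [hX]
      rw [this, ← map_mul, MvPowerSeries.inv_mul_cancel _ (by simp), map_one]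
  have hA : MvPowerSeries.killCompl e
      (alternant (Signature.zero (N + 1)) (MvPowerSeries.X (R := ℂ))) =
      (∏ i, MvPowerSeries.X i) * alternant (Signature.zero N) MvPowerSeries.X := by
    unfold alternant
    rw [AlgHom.map_det, Matrix.det_succ_row _ (Fin.last N), Fin.sum_univ_castSucc,
      Finset.sum_eq_zero, zero_add]
    · rw [← Matrix.det_mul_column]
      simp only [Fin.succAbove_last]
      have hs : (Even ((Fin.last N : ℕ) + (Fin.last N : ℕ))) := ⟨_, rfl⟩
      rw [hs.neg_one_pow, one_mul]
      have h1 : (Signature.zero (N + 1)).shifted (Fin.last N) = 0 := by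
        simp [Signature.zero, Signature.shifted]
      have h2 : ∀ j : Fin N, (Signature.zero (N + 1)).shifted j.castSucc =
          (Signature.zero N).shifted j + 1 := by
        intro j
        have := j.isLt
        simp [Signature.zero, Signature.shifted]
        omega
      simp only [AlgHom.mapMatrix_apply, Matrix.map_apply, Matrix.of_apply, h1, pow_zero, map_one,
        one_mul]
      congr 1
      ext i j : 2
      simp only [Matrix.submatrix_apply, Matrix.map_apply, Matrix.of_apply, map_pow, hX, h2]
      exact congrArg _ (pow_succ' _ _)
    · intro j _
      have h2 : (Signature.zero (N + 1)).shifted j.castSucc ≠ 0 := by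
        have := j.isLt
        simp [Signature.zero, Signature.shifted]
        omega
      simp [hX0, h2]
  have he : l.snocZero.exponent = (l.exponent + ∑ i, Finsupp.single i 1).embDomain e := by
    ext i
    induction i using Fin.lastCases with
    | last =>
      rw [Finsupp.embDomain_of_notMem_range]
      · simp [Signature.exponent, Signature.shifted, Signature.snocZero]
      · rintro ⟨i, hi⟩
        exact (Fin.castSucc_lt_last i).ne hi
    | cast i =>
      have h1 := Finsupp.embDomain_apply_self e (l.exponent + ∑ i, Finsupp.single i 1) i
      refine Eq.trans ?_ h1.symm
      have := i.isLt
      simp [Signature.exponent, Signature.shifted, Signature.snocZero, Finsupp.single_apply]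
      omega
  rw [he, ← MvPowerSeries.coeff_killCompl, map_mul, hA, hK, mul_assoc]
  have hm : (∏ i : Fin N, MvPowerSeries.X (R := ℂ) i) =
      MvPowerSeries.monomial (∑ i, Finsupp.single i 1) 1 := by
    simp only [MvPowerSeries.X]
    rw [MvPowerSeries.prod_monomial]
    simp
  rw [hm, add_comm, MvPowerSeries.coeff_add_monomial_mul, one_mul]

end FreeFermion

open FreeFermion

/-! The weights are free fermionic: the weight of a doubly occupied vertex is `turnRight * turnUp -
vert * horiz`, a 2×2 minor of the one-particle weights up to sign. Hence a row acts on exterior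
products through its action on single vectors (`wedgeFactor_mul_wedgeFactor`,
`wedge_mul_wedgeFactor_eq_sum`). When all columns have the same parameters, this one-particle action
is multiplication by a power series, `FermionRow.series`, which has the form (α + βX)/(1 - hX). Any
number of rows gives the product of their series, and the partition function becomes a determinant
of coefficients (`sum_prod_rowSum_eq_topForm`).

For `G` no path leaves through the side, so the determinant is of Jacobi–Trudi type for the product
of the series (`G_eq_jacobiTrudi`). Splitting a constant off each series leaves ∏ (1 + bX)/(1 - aX),
and `supersymSchur_eq_jacobiTrudi` identifies the result.

For `F` the vacuum of a row is an occupied horizontal line. Exchanging particles and holes on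
horizontal edges and reflecting the columns gives a free fermionic model again, in which one path
leaves through the side of each row. The result is a determinant of coefficients of the series
`sideSeries` (`F_eq_det`), which is evaluated in two ways. For distinct parameters, partial
fractions express these series triangularly in the geometric series with ratios `(p i).horiz`, which
yields the alternant and an explicit product (`det_coeff_sideSeries_eq_alternant`). In general they
share the denominator ∏ (1 - tᵢX) and have numerators of degree less than `n`. The dependence on λ
therefore factors out as a Jacobi–Trudi determinant, a Schur polynomial, without distinctness
(`det_coeff_sideSeries`, `eval_schur`). -/

namespace FreeFermion

/-! ### Sums over tuples -/

theorem sum_fin_snoc {α M : Type*} [Fintype α] [AddCommMonoid M] {n : ℕ}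
    (f : (Fin (n + 1) → α) → M) :
    ∑ v, f v = ∑ v : Fin n → α, ∑ a : α, f (Fin.snoc v a) := by
  rw [← (Fin.snocEquiv fun _ => α).sum_comp, Fintype.sum_prod_type_right]
  rfl

theorem sum_fin_cons {α M : Type*} [Fintype α] [AddCommMonoid M] {n : ℕ}
    (f : (Fin (n + 1) → α) → M) :
    ∑ v, f v = ∑ v : Fin n → α, ∑ a : α, f (Fin.cons a v) := by
  rw [← (Fin.consEquiv fun _ => α).sum_comp, Fintype.sum_prod_type_right]
  rfl

/-! ### Free fermionic rows -/

/-- The sum over the states of the horizontal edges of a row with `L` columns of the products of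
the vertex weights `ω`, with given states `b` and `t` of the bottom and top edges, empty left
boundary and state `ρ` of the right boundary. -/
def rowSum {R : Type*} [CommSemiring R] {L : ℕ} (ω : Fin L → Bool → Bool → Bool → Bool → R)
    (b t : Fin L → Bool) (ρ : Bool) : R :=
  ∑ h : Fin (L + 1) → Bool, if h 0 = false ∧ h (Fin.last L) = ρ then
    ∏ c, ω c (b c) (h c.castSucc) (t c) (h c.succ) else 0

theorem rowSum_zero {R : Type*} [CommSemiring R] (ω : Fin 0 → Bool → Bool → Bool → Bool → R)
    (b t : Fin 0 → Bool) (ρ : Bool) : rowSum ω b t ρ = if ρ = false then 1 else 0 := by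
  unfold rowSum
  rw [← (Equiv.funUnique (Fin 1) Bool).symm.sum_comp]
  cases ρ <;> simp

theorem rowSum_snoc {R : Type*} [CommSemiring R] {L : ℕ}
    (ω : Fin (L + 1) → Bool → Bool → Bool → Bool → R) (b t : Fin L → Bool) (i τ ρ : Bool) :
    rowSum ω (Fin.snoc b i) (Fin.snoc t τ) ρ =
      ∑ h, rowSum (fun c => ω c.castSucc) b t h * ω (Fin.last L) i h τ ρ := by
  unfold rowSum
  rw [sum_fin_snoc]
  simp only [Fin.snoc_last, Finset.sum_mul]
  rw [Finset.sum_comm]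
  conv_rhs => rw [Finset.sum_comm]
  rw [Finset.sum_comm]
  refine Finset.sum_congr rfl fun v _ => ?_
  have h0 : ∀ a : Bool, (Fin.snoc v a : Fin (L + 2) → Bool) 0 = v 0 := fun a => by
    rw [← Fin.castSucc_zero, Fin.snoc_castSucc]
  simp only [h0, Fin.prod_univ_castSucc, Fin.snoc_castSucc, Fin.snoc_last,
    Fin.succ_castSucc, Fin.succ_last]
  -- The boundary conditions fix the new right edge on one side and the intermediate edge on the
  -- other.
  rw [Finset.sum_eq_single ρ, Finset.sum_eq_single (v (Fin.last L))]
  · by_cases hv : v 0 = false <;> simp [hv]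
  · intro a _ ha
    simp [Ne.symm ha]
  · simp
  · intro a _ ha
    simp [ha]
  · simp

/-- The parameters of a free fermionic row: the weights of a path going straight up, going
straight to the right, turning to the right, and turning up. -/
structure FermionRow (R : Type*) where
  vert : R
  horiz : R
  turnRight : R
  turnUp : R

/-- The vertex weights of a free fermionic row, with arguments the bottom, left, top and right
edges. -/
def FermionRow.weight {R : Type*} [CommRing R] (p : FermionRow R) : Bool → Bool → Bool → Bool → R
  | false, false, false, false => 1
  | true, false, true, false => p.vert
  | false, true, false, true => p.horiz
  | true, false, false, true => p.turnRight
  | false, true, true, false => p.turnUp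
  | true, true, true, true => p.turnRight * p.turnUp - p.vert * p.horiz
  | _, _, _, _ => 0

/-! ### Exterior products and the action of a row on them -/

section Wedge

variable {R V : Type*} [CommRing R] [AddCommGroup V] [Module R V]

/-- The factor `v` if `b` is occupied, and `1` otherwise. -/
def wedgeFactor (R : Type*) {V : Type*} [CommRing R] [AddCommGroup V] [Module R V] (v : V)
    (b : Bool) : ExteriorAlgebra R V :=
  if b then ExteriorAlgebra.ι R v else 1

/-- The exterior product of the `u c`, in increasing order, over the occupied positions `c`. -/
def wedge (R : Type*) {V : Type*} [CommRing R] [AddCommGroup V] [Module R V] (u : ℕ → V) {L : ℕ}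
    (b : Fin L → Bool) : ExteriorAlgebra R V :=
  (List.ofFn fun c : Fin L => wedgeFactor R (u c) (b c)).prod

theorem wedge_snoc (u : ℕ → V) {L : ℕ} (b : Fin L → Bool) (i : Bool) :
    wedge R u (Fin.snoc b i : Fin (L + 1) → Bool) = wedge R u b * wedgeFactor R (u L) i := by
  unfold wedge
  rw [List.ofFn_succ', List.prod_concat]
  simp

/-- A vertex is a linear change of two vectors. For τ = ρ = true the product is `vert * horiz` times
u ∧ w plus `turnUp * turnRight` times w ∧ u; swapping u and w produces exactly the free fermionic
weight. -/
theorem wedgeFactor_mul_wedgeFactor (p : FermionRow R) {u u' w w' : V}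
    (hu : u' = p.vert • u + p.turnUp • w) (hw : w' = p.turnRight • u + p.horiz • w)
    (τ ρ : Bool) :
    wedgeFactor R u' τ * wedgeFactor R w' ρ =
      ∑ h, ∑ i, p.weight i h τ ρ • (wedgeFactor R w h * wedgeFactor R u i) := by
  have h3 := ExteriorAlgebra.ι_add_mul_swap (R := R) u w
  have h4 := ExteriorAlgebra.ι_sq_zero (R := R) u
  have h5 := ExteriorAlgebra.ι_sq_zero (R := R) w
  have h6 : ExteriorAlgebra.ι R u * ExteriorAlgebra.ι R w =
      -(ExteriorAlgebra.ι R w * ExteriorAlgebra.ι R u) := eq_neg_of_add_eq_zero_left h3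
  rw [hu, hw]
  cases τ <;> cases ρ <;>
    simp only [wedgeFactor, FermionRow.weight, Fintype.sum_bool, if_true, if_false, map_add,
      map_smul, mul_add, add_mul, smul_mul_assoc, mul_smul_comm, h4, h5, h6, smul_zero, smul_smul,
      sub_smul, one_mul, mul_one, zero_smul, one_smul, zero_add, add_zero, Bool.false_eq_true,
      smul_neg]
  · exact add_comm _ _
  · exact add_comm _ _
  · rw [mul_comm p.horiz, ← sub_eq_add_neg]

/-- The action of a free fermionic row on exterior products: it replaces the vector `u c` at the
column `c` by `u' c`, where `w c` is the vector at the horizontal edge to the left of the column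
`c`. -/
theorem wedge_mul_wedgeFactor_eq_sum (p : FermionRow R) {u u' w : ℕ → V} (h0 : w 0 = 0)
    (hu : ∀ c, u' c = p.vert • u c + p.turnUp • w c)
    (hw : ∀ c, w (c + 1) = p.turnRight • u c + p.horiz • w c) {L : ℕ} (t : Fin L → Bool)
    (ρ : Bool) :
    wedge R u' t * wedgeFactor R (w L) ρ =
      ∑ b : Fin L → Bool, rowSum (fun _ => p.weight) b t ρ • wedge R u b := by
  induction L generalizing ρ with
  | zero => cases ρ <;> simp [wedge, wedgeFactor, rowSum_zero, h0]
  | succ L ih =>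
    obtain ⟨t, τ, rfl⟩ : ∃ (t' : Fin L → Bool) (τ : Bool), t = Fin.snoc t' τ :=
      ⟨Fin.init t, t (Fin.last L), (Fin.snoc_init_self t).symm⟩
    -- The horizontal factor is carried leftwards through the last column, where it meets the first
    -- `L` columns in the form the induction hypothesis needs.
    rw [wedge_snoc, mul_assoc, wedgeFactor_mul_wedgeFactor p (hu L) (hw L), sum_fin_snoc]
    simp only [rowSum_snoc, wedge_snoc, Finset.mul_sum, mul_smul_comm, ← mul_assoc, ih,
      Finset.sum_mul, Finset.smul_sum, Finset.sum_smul, smul_mul_assoc, smul_smul]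
    rw [Finset.sum_comm]
    conv_rhs => rw [Finset.sum_comm]
    refine Finset.sum_congr rfl fun i _ => ?_
    rw [Finset.sum_comm]
    refine Finset.sum_congr rfl fun b _ => Finset.sum_congr rfl fun h _ => ?_
    rw [mul_comm]

/-- The enumeration `g` of the occupied positions is chosen before `u`, so it serves every family of
vectors. -/
theorem exists_wedge_eq_ιMulti {L : ℕ} (b : Fin L → Bool) :
    ∃ (n : ℕ) (g : Fin n → Fin L), StrictMono g ∧ (∀ c, b c = true ↔ c ∈ Set.range g) ∧
      ∀ u : ℕ → V, wedge R u b = ExteriorAlgebra.ιMulti R n fun i => u (g i) := by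
  induction L with
  | zero =>
    refine ⟨0, Fin.elim0, fun i => i.elim0, fun c => c.elim0, fun u => ?_⟩
    simp [wedge, ExteriorAlgebra.ιMulti_apply]
  | succ L ih =>
    obtain ⟨b, i, rfl⟩ : ∃ (b' : Fin L → Bool) (i : Bool), b = Fin.snoc b' i :=
      ⟨Fin.init b, b (Fin.last L), (Fin.snoc_init_self b).symm⟩
    obtain ⟨n, g, hg, hr, hw⟩ := ih b
    cases i
    · refine ⟨n, Fin.castSucc ∘ g, Fin.strictMono_castSucc.comp hg, fun c => ?_, fun u => ?_⟩
      · induction c using Fin.lastCases with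
        | last => simp [Fin.castSucc_ne_last]
        | cast c => simp [hr]
      · simp [wedge_snoc, hw, wedgeFactor]
    · refine ⟨n + 1, Fin.snoc (α := fun _ => Fin (L + 1)) (Fin.castSucc ∘ g) (Fin.last L), ?_,
        fun c => ?_, fun u => ?_⟩
      · intro i j hij
        induction j using Fin.lastCases with
        | last =>
          induction i using Fin.lastCases with
          | last => exact absurd hij (lt_irrefl _)
          | cast i => simp
        | cast j =>
          induction i using Fin.lastCases with
          | last => exact absurd hij (by simp [Fin.le_last])
          | cast i => simpa using hg (by simpa using hij)
      · induction c using Fin.lastCases with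
        | last => simp
        | cast c =>
          rw [Fin.snoc_castSucc, hr]
          constructor
          · rintro ⟨i, rfl⟩
            exact ⟨i.castSucc, by simp⟩
          · rintro ⟨i, hi⟩
            induction i using Fin.lastCases with
            | last => exact absurd hi.symm (by simp [Fin.castSucc_ne_last])
            | cast i => exact ⟨i, by simpa using hi⟩
      · rw [wedge_snoc, hw, ExteriorAlgebra.ιMulti_apply, ExteriorAlgebra.ιMulti_apply,
          List.ofFn_succ', List.prod_concat]
        simp [wedgeFactor]

end Wedge

/-- The linear functional on the exterior algebra of `R^n` which is the determinant in degree `n`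
and zero in all other degrees. -/
noncomputable def topForm (R : Type*) [CommRing R] (n : ℕ) :
    ExteriorAlgebra R (Fin n → R) →ₗ[R] R :=
  ExteriorAlgebra.liftAlternating fun m =>
    if h : m = n then h ▸ Matrix.detRowAlternating else 0

theorem topForm_ιMulti {R : Type*} [CommRing R] {n : ℕ} (v : Fin n → Fin n → R) :
    topForm R n (ExteriorAlgebra.ιMulti R n v) = (Matrix.of v).det := by
  simp [topForm, ExteriorAlgebra.liftAlternating_apply_ιMulti]
  rfl

theorem topForm_ιMulti_of_ne {R : Type*} [CommRing R] {m n : ℕ} (h : m ≠ n)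
    (v : Fin m → Fin n → R) : topForm R n (ExteriorAlgebra.ιMulti R m v) = 0 := by
  simp [topForm, ExteriorAlgebra.liftAlternating_apply_ιMulti, h]

theorem wedge_eq_ιMulti {R V : Type*} [CommRing R] [AddCommGroup V] [Module R V] {n L : ℕ}
    {f : Fin n → Fin L} (hf : StrictMono f) {b : Fin L → Bool}
    (hb : ∀ c, b c = true ↔ c ∈ Set.range f) (u : ℕ → V) :
    wedge R u b = ExteriorAlgebra.ιMulti R n fun i => u (f i) := by
  obtain ⟨m, g, hg, hr, hw⟩ := exists_wedge_eq_ιMulti (R := R) (V := V) b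
  have h1 : Set.range g = Set.range f := Set.ext fun c => by rw [← hr, hb]
  obtain rfl : m = n := by
    have h2 := Set.card_range_of_injective hg.injective
    have h3 := Set.card_range_of_injective hf.injective
    simp only [h1, Fintype.card_fin] at h2 h3
    omega
  rw [hw, (StrictMono.range_inj hg hf).1 h1]

/-- Standard basis vectors sit at the positions `f i` and zero elsewhere, so the top form detects a
single state. This is how a prescribed bottom boundary is selected. -/
theorem topForm_wedge {R : Type*} [CommRing R] {n L : ℕ} {f : Fin n → Fin L} (hf : StrictMono f)
    {b₀ : Fin L → Bool} (hb₀ : ∀ c, b₀ c = true ↔ c ∈ Set.range f) (b : Fin L → Bool) :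
    topForm R n (wedge R (fun c i => if c = f i then 1 else 0) b) = if b = b₀ then 1 else 0 := by
  split_ifs with h
  · subst h
    rw [wedge_eq_ιMulti hf hb₀, topForm_ιMulti, ← Matrix.det_one (R := R) (n := Fin n)]
    congr 1
    ext i j
    simp [Matrix.one_apply, Fin.val_inj, hf.injective.eq_iff]
  · obtain ⟨m, g, hg, hr, hw⟩ := exists_wedge_eq_ιMulti (R := R) (V := Fin n → R) b
    rw [hw]
    by_cases hm : m = n
    · subst hm
      rw [topForm_ιMulti]
      -- With equally many particles, a state different from `b₀` misses some position `f j`, and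
      -- the column `j` vanishes.
      obtain ⟨j, hj⟩ : ∃ j, f j ∉ Set.range g := by
        by_contra! hfg
        have h1 : Set.range f ⊆ Set.range g := Set.range_subset_iff.2 hfg
        have h2 : Set.range f = Set.range g := Set.eq_of_subset_of_card_le h1 (by
          rw [Set.card_range_of_injective hg.injective, Set.card_range_of_injective hf.injective])
        refine h (funext fun c => ?_)
        rw [Bool.eq_iff_iff, hr, hb₀, h2]
      refine Matrix.det_eq_zero_of_column_eq_zero j fun i => ?_
      have : (g i : ℕ) ≠ f j := fun h => hj ⟨i, Fin.ext h⟩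
      simp [this]
    · exact topForm_ιMulti_of_ne hm _

/-! ### Power series attached to rows -/

section Series

variable {R : Type*} [CommRing R]

/-- The geometric series `∑ tⁿ Xⁿ`. -/
noncomputable def geom (t : R) : PowerSeries R := PowerSeries.mk fun n => t ^ n

@[simp]
theorem coeff_geom (t : R) (n : ℕ) : PowerSeries.coeff n (geom t) = t ^ n :=
  PowerSeries.coeff_mk _ _

theorem one_sub_mul_geom (t : R) : (1 - PowerSeries.C t * PowerSeries.X) * geom t = 1 := by
  ext n
  rw [sub_mul, one_mul, mul_assoc, map_sub, PowerSeries.coeff_C_mul]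
  cases n with
  | zero => simp
  | succ n => simp [PowerSeries.coeff_succ_X_mul, PowerSeries.coeff_one, pow_succ']

theorem coeff_succ_X_mul_geom_mul (t : R) (f : PowerSeries R) (n : ℕ) :
    PowerSeries.coeff (n + 1) (PowerSeries.X * geom t * f) =
      PowerSeries.coeff n f + t * PowerSeries.coeff n (PowerSeries.X * geom t * f) := by
  have h : PowerSeries.X * geom t * f = PowerSeries.X * (f + PowerSeries.C t *
      (PowerSeries.X * geom t * f)) := by
    linear_combination (PowerSeries.X * f) * one_sub_mul_geom t
  rw [h, PowerSeries.coeff_succ_X_mul, map_add, PowerSeries.coeff_C_mul, ← h]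

/-- The generating function of the weights of the one-particle transitions in a row: the
coefficient of `Xⁿ` is the weight of a path that enters at the bottom and leaves at the top `n`
columns further to the right. -/
noncomputable def FermionRow.series (p : FermionRow R) : PowerSeries R :=
  PowerSeries.C p.vert + PowerSeries.C (p.turnUp * p.turnRight) * (PowerSeries.X * geom p.horiz)

/-- The generating function of the weights of the paths in a row that enter at the bottom and
leave to the right. -/
noncomputable def FermionRow.exitSeries (p : FermionRow R) : PowerSeries R :=
  PowerSeries.C p.turnRight * (PowerSeries.X * geom p.horiz)

variable {n : ℕ}

/-- Since all columns are alike, the recursion along the row is solved by generating functions in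
the column. The factor X in `exitSeries` makes the vector at the left boundary zero. -/
theorem wedge_series_mul_wedgeFactor_eq_sum (p : FermionRow R) (U : Fin n → PowerSeries R) {L : ℕ}
    (t : Fin L → Bool) (ρ : Bool) :
    wedge R (fun c i => PowerSeries.coeff c (p.series * U i)) t *
        wedgeFactor R (fun i => PowerSeries.coeff L (p.exitSeries * U i)) ρ =
      ∑ b : Fin L → Bool, rowSum (fun _ => p.weight) b t ρ •
        wedge R (fun c i => PowerSeries.coeff c (U i)) b := by
  refine wedge_mul_wedgeFactor_eq_sum p
    (w := fun c i => PowerSeries.coeff c (p.exitSeries * U i)) ?_ ?_ ?_ t ρ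
  · ext i
    simp [FermionRow.exitSeries, mul_assoc]
  · intro c
    ext i
    simp [FermionRow.exitSeries, FermionRow.series, add_mul, mul_assoc]
  · intro c
    ext i
    simp only [FermionRow.exitSeries, Pi.add_apply, Pi.smul_apply, smul_eq_mul]
    rw [mul_assoc, PowerSeries.coeff_C_mul, PowerSeries.coeff_C_mul, coeff_succ_X_mul_geom_mul]
    ring

theorem prod_Iio_succ {M : Type*} [CommMonoid M] {k : ℕ} (f : Fin (k + 1) → M) (j : Fin k) :
    ∏ i ∈ Finset.Iio j.succ, f i = f 0 * ∏ i ∈ Finset.Iio j, f i.succ := by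
  have h : ∀ {m : ℕ} (a : Fin m), Finset.Iio a = Finset.univ.filter (· < a) := fun a => by
    ext
    simp
  rw [h, h, Finset.prod_filter, Finset.prod_filter, Fin.prod_univ_succ]
  simp

/-- Peeling off the bottom row replaces `U` by `(p 0).series * U` and puts the side factor of that
row rightmost; this is why the list of side factors is reversed. -/
theorem sum_prod_rowSum_smul_wedge {k : ℕ} (p : Fin k → FermionRow R)
    (U : Fin n → PowerSeries R) {L : ℕ} (t : Fin L → Bool) (ρ : Bool) :
    ∑ v : Fin (k + 1) → Fin L → Bool, (if v (Fin.last k) = t then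
        ∏ j, rowSum (fun _ => (p j).weight) (v j.castSucc) (v j.succ) ρ else 0) •
        wedge R (fun c i => PowerSeries.coeff c (U i)) (v 0) =
      wedge R (fun c i => PowerSeries.coeff c ((∏ j, (p j).series) * U i)) t *
        ((List.ofFn fun j => wedgeFactor R (fun i => PowerSeries.coeff L
          ((p j).exitSeries * (∏ j' ∈ Finset.Iio j, (p j').series) * U i)) ρ).reverse).prod := by
  induction k generalizing U with
  | zero =>
    rw [← (Equiv.funUnique (Fin 1) (Fin L → Bool)).symm.sum_comp]
    simp [ite_smul]
  | succ k ih =>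
    rw [sum_fin_cons]
    have h1 : ∀ (v : Fin (k + 1) → Fin L → Bool) (a : Fin L → Bool),
        (if (Fin.cons a v : Fin (k + 2) → Fin L → Bool) (Fin.last (k + 1)) = t then
          ∏ j : Fin (k + 1), rowSum (fun _ => (p j).weight)
            ((Fin.cons a v : Fin (k + 2) → Fin L → Bool) j.castSucc)
            ((Fin.cons a v : Fin (k + 2) → Fin L → Bool) j.succ) ρ else 0) =
        (if v (Fin.last k) = t then
          ∏ j : Fin k, rowSum (fun _ => (p j.succ).weight) (v j.castSucc) (v j.succ) ρ else 0) *
          rowSum (fun _ => (p 0).weight) a (v 0) ρ := by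
      intro v a
      rw [Fin.prod_univ_succ, ← Fin.succ_last]
      simp only [Fin.cons_succ, Fin.castSucc_zero, Fin.cons_zero, ← Fin.succ_castSucc, ite_mul,
        zero_mul]
      rw [mul_comm]
    simp only [h1, Fin.cons_zero, mul_smul, ← Finset.smul_sum]
    simp only [← wedge_series_mul_wedgeFactor_eq_sum]
    simp only [← smul_mul_assoc]
    rw [← Finset.sum_mul, ih (fun j => p j.succ) (fun i => (p 0).series * U i), List.ofFn_succ,
      List.reverse_cons, List.prod_append, List.prod_singleton, mul_assoc]
    have h0 : Finset.Iio (0 : Fin (k + 1)) = ∅ := by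
      ext
      simp
    simp only [prod_Iio_succ, Fin.prod_univ_succ, h0, Finset.prod_empty, mul_one]
    have h2 : ∀ (f g h : PowerSeries R), f * (g * h) = g * f * h := fun f g h => by ring
    have h3 : ∀ (e f g h : PowerSeries R), e * f * (g * h) = e * (g * f) * h :=
      fun e f g h => by ring
    simp only [h2 (∏ j : Fin k, _), h3]

/-- The position-space form: the sum over all configurations of a rectangle with `k` free
fermionic rows with given occupied positions `f` of the bottom boundary. -/
theorem sum_prod_rowSum_eq_topForm {k : ℕ} (p : Fin k → FermionRow R) {L : ℕ}
    {f : Fin n → Fin L} (hf : StrictMono f) {b : Fin L → Bool}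
    (hb : ∀ c, b c = true ↔ c ∈ Set.range f) (t : Fin L → Bool) (ρ : Bool) :
    ∑ v : Fin (k + 1) → Fin L → Bool, (if v 0 = b ∧ v (Fin.last k) = t then
        ∏ j, rowSum (fun _ => (p j).weight) (v j.castSucc) (v j.succ) ρ else 0) =
      topForm R n (wedge R (fun c i => PowerSeries.coeff c
          ((∏ j, (p j).series) * PowerSeries.X ^ (f i : ℕ))) t *
        ((List.ofFn fun j => wedgeFactor R (fun i => PowerSeries.coeff L
          ((p j).exitSeries * (∏ j' ∈ Finset.Iio j, (p j').series) *
            PowerSeries.X ^ (f i : ℕ))) ρ).reverse).prod) := by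
  rw [← sum_prod_rowSum_smul_wedge, map_sum]
  refine Finset.sum_congr rfl fun v _ => ?_
  rw [map_smul]
  -- The initial series X ^ f i are point masses, which are the vectors of `topForm_wedge`.
  simp only [PowerSeries.coeff_X_pow]
  rw [topForm_wedge hf hb]
  by_cases h : v 0 = b <;> simp [h]

end Series

/-! ### Reduction of the partition functions to finite sums -/

/-- Extension of an assignment on a rectangle with `L` columns by the empty state of the vertical
edges and the state `right` of the horizontal edges. -/
def Configuration.ofRectangle {k L : ℕ} (right : Bool)
    (q : (Fin (k + 1) → Fin L → Bool) × (Fin k → Fin (L + 1) → Bool)) : Configuration k where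
  vert j c := if h : c < L then q.1 j ⟨c, h⟩ else false
  horiz j c := if h : c < L + 1 then q.2 j ⟨c, h⟩ else right

theorem Configuration.ofRectangle_injective {k L : ℕ} (right : Bool) :
    Function.Injective (Configuration.ofRectangle (k := k) (L := L) right) := by
  intro q q' h
  simp only [Configuration.ofRectangle, Configuration.mk.injEq] at h
  refine Prod.ext (funext₂ fun j c => ?_) (funext₂ fun j c => ?_)
  · simpa using congrFun (congrFun h.1 j) c
  · simpa [-Order.lt_add_one_iff] using congrFun (congrFun h.2 j) c

theorem prod_rowSum {R : Type*} [CommSemiring R] {k L : ℕ}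
    (ω : Fin k → Fin L → Bool → Bool → Bool → Bool → R) (v : Fin (k + 1) → Fin L → Bool)
    (ρ : Bool) :
    ∏ j, rowSum (ω j) (v j.castSucc) (v j.succ) ρ =
      ∑ h : Fin k → Fin (L + 1) → Bool, if ∀ j, h j 0 = false ∧ h j (Fin.last L) = ρ then
        ∏ j, ∏ c, ω j c (v j.castSucc c) (h j c.castSucc) (v j.succ c) (h j c.succ) else 0 := by
  simp only [rowSum, Finset.prod_univ_sum, Fintype.piFinset_univ, Finset.prod_ite_zero,
    Finset.mem_univ, true_imp_iff]

/-- By `hC` admissible configurations are frozen from column `L` on, and by `hvac` the vertices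
there have weight 1. The finite sum also runs over assignments that violate conservation, but `hw`
gives these weight 0. -/
theorem partitionFunction_eq_sum {k : ℕ} {w : ℕ → Fin k → Bool → Bool → Bool → Bool → ℂ}
    {bottom top : Set ℕ} {right : Bool} {L : ℕ}
    (hw : ∀ c j i₁ j₁ i₂ j₂, Bool.toNat i₁ + Bool.toNat j₁ ≠ Bool.toNat i₂ + Bool.toNat j₂ →
      w c j i₁ j₁ i₂ j₂ = 0)
    (hvac : ∀ c j, w c j false right false right = 1)
    (hC : ∀ C : Configuration k, C.IsAdmissible bottom top right → ∀ c, L ≤ c →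
      (∀ j, C.vert j c = false) ∧ ∀ j, C.horiz j c = right)
    {b t : Fin L → Bool} (hbL : ∀ c ∈ bottom, c < L) (htL : ∀ c ∈ top, c < L)
    (hb : ∀ c, b c = true ↔ (c : ℕ) ∈ bottom) (ht : ∀ c, t c = true ↔ (c : ℕ) ∈ top) :
    partitionFunction w bottom top right =
      ∑ v : Fin (k + 1) → Fin L → Bool, if v 0 = b ∧ v (Fin.last k) = t then
        ∏ j, rowSum (fun c => w c j) (v j.castSucc) (v j.succ) right else 0 := by
  classical
  have himage : {C : Configuration k | C.IsAdmissible bottom top right} =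
      Configuration.ofRectangle (L := L) right ''
        {q | (Configuration.ofRectangle right q).IsAdmissible bottom top right} := by
    ext C
    constructor
    · intro h
      refine ⟨(fun j c => C.vert j c, fun j c => C.horiz j c), ?_, ?_⟩
      all_goals
        have hq : Configuration.ofRectangle (L := L) right
            (fun j c => C.vert j c, fun j c => C.horiz j c) = C := by
          obtain ⟨vert, horiz⟩ := C
          simp only [Configuration.ofRectangle, Configuration.mk.injEq]
          constructor
          · ext j c
            split_ifs with hc
            · rfl
            · exact (((hC _ h c (by omega)).1 j)).symm ▸ rfl
          · ext j c
            split_ifs with hc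
            · rfl
            · exact (((hC _ h c (by omega)).2 j)).symm ▸ rfl
      · simpa only [Set.mem_ofPred_eq, hq] using h
      · exact hq
    · rintro ⟨q, hq, rfl⟩
      exact hq
  have hweight : ∀ q : (Fin (k + 1) → Fin L → Bool) × (Fin k → Fin (L + 1) → Bool),
      (∀ j, q.2 j (Fin.last L) = right) →
      (Configuration.ofRectangle right q).weight w =
        ∏ j, ∏ c : Fin L, w c j (q.1 j.castSucc c) (q.2 j c.castSucc) (q.1 j.succ c)
          (q.2 j c.succ) := by
    intro q hq
    unfold Configuration.weight
    rw [finprod_eq_prod_of_mulSupport_subset (s := Finset.range L ×ˢ Finset.univ),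
      Finset.prod_product_right]
    · refine Finset.prod_congr rfl fun j _ => ?_
      rw [← Fin.prod_univ_eq_prod_range (fun c => w c j _ _ _ _)]
      refine Finset.prod_congr rfl fun c _ => ?_
      have h1 : (c : ℕ) < L + 1 := by omega
      simp [Configuration.ofRectangle, h1, -Order.lt_add_one_iff]
      rfl
    · rintro ⟨c, j⟩ h
      by_contra hc
      have hc : L ≤ c := by simpa using hc
      apply h
      have h1 : ¬ c < L := by omega
      have h2 : ¬ c + 1 < L + 1 := by omega
      have h3 : (if h : c < L + 1 then q.2 j ⟨c, h⟩ else right) = right := by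
        split_ifs with h
        · have h4 : c = L := by omega
          subst h4
          exact hq j
        · rfl
      simp only [Configuration.ofRectangle, h1, h2, h3, dif_neg, not_false_eq_true, hvac]
  unfold partitionFunction
  rw [himage, finsum_mem_image (Configuration.ofRectangle_injective right).injOn,
    finsum_mem_def, finsum_eq_sum_of_fintype]
  simp only [Set.indicator_apply]
  rw [Fintype.sum_prod_type]
  have hterm : ∀ v h, (if (v, h) ∈ {q : (Fin (k + 1) → Fin L → Bool) ×
        (Fin k → Fin (L + 1) → Bool) |
        (Configuration.ofRectangle right q).IsAdmissible bottom top right}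
      then (Configuration.ofRectangle right (v, h)).weight w else 0) =
      if v 0 = b ∧ v (Fin.last k) = t then
        (if ∀ j, h j 0 = false ∧ h j (Fin.last L) = right then
          ∏ j, ∏ c : Fin L, w c j (v j.castSucc c) (h j c.castSucc) (v j.succ c)
            (h j c.succ) else 0) else 0 := by
    intro v h
    simp only [Set.mem_ofPred_eq]
    have hvert : ∀ (j) (c : Fin L), (Configuration.ofRectangle right (v, h)).vert j c = v j c :=
      fun j c => by simp [Configuration.ofRectangle]
    have hhoriz : ∀ (j) (c : Fin (L + 1)),
        (Configuration.ofRectangle right (v, h)).horiz j c = h j c :=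
      fun j c => by simp [Configuration.ofRectangle, -Order.lt_add_one_iff]
    have hiff : ∀ (S : Set ℕ) (σ : Fin L → Bool), (∀ c ∈ S, c < L) →
        (∀ c, σ c = true ↔ (c : ℕ) ∈ S) → ∀ j, v j = σ ↔
          ∀ c, (Configuration.ofRectangle right (v, h)).vert j c = true ↔ c ∈ S := by
      intro S σ hS hσ j
      constructor
      · rintro hv c
        by_cases hc : c < L
        · simpa [Configuration.ofRectangle, hc, hv] using hσ ⟨c, hc⟩
        · simpa [Configuration.ofRectangle, hc] using fun h => hc (hS c h)
      · intro hv
        ext c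
        rw [Bool.eq_iff_iff, hσ, ← hv, hvert]
    by_cases hadm : (Configuration.ofRectangle right (v, h)).IsAdmissible bottom top right
    · have hright : ∀ j, h j (Fin.last L) = right := fun j => by
        rw [← hhoriz]
        exact (hC _ hadm _ le_rfl).2 j
      have hleft : ∀ j, h j 0 = false := fun j => by
        rw [← hhoriz]
        exact hadm.left_empty j
      rw [if_pos hadm, if_pos ⟨(hiff _ _ hbL hb 0).2 hadm.bottom_iff,
        (hiff _ _ htL ht _).2 hadm.top_iff⟩, if_pos fun j => ⟨hleft j, hright j⟩,
        hweight _ hright]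
    · rw [if_neg hadm]
      split_ifs with h1 h2
      -- All boundary conditions hold here, so only conservation at a vertex inside the rectangle
      -- can fail.
      · have h3 : ∃ (j : Fin k) (c : Fin L), (v j.castSucc c).toNat + (h j c.castSucc).toNat ≠
            (v j.succ c).toNat + (h j c.succ).toNat := by
          by_contra! hcons
          have hfar : ∀ j c, L ≤ c →
              (Configuration.ofRectangle right (v, h)).horiz j c = right := by
            intro j c hc
            rcases hc.eq_or_lt with rfl | hc
            · exact (hhoriz j (Fin.last _)).trans (h2 j).2
            · have : ¬ c < L + 1 := by omega
              simp only [Configuration.ofRectangle, this, dif_neg, not_false_eq_true]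
          refine hadm ⟨fun j c => ?_, (hiff _ _ hbL hb 0).1 h1.1, (hiff _ _ htL ht _).1 h1.2,
            fun j => (hhoriz j 0).trans (h2 j).1,
            fun j => Filter.eventually_atTop.2 ⟨L, fun c hc => hfar j c hc⟩⟩
          by_cases hc : c < L
          · have := hcons j ⟨c, hc⟩
            rw [← hvert, ← hvert, ← hhoriz, ← hhoriz] at this
            exact this
          · have hv : ∀ j, (Configuration.ofRectangle right (v, h)).vert j c = false :=
              fun j => by simp [Configuration.ofRectangle, hc]
            rw [hv, hv, hfar j c (by omega), hfar j (c + 1) (by omega)]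
        obtain ⟨j, c, hjc⟩ := h3
        exact (Finset.prod_eq_zero (Finset.mem_univ j)
          (Finset.prod_eq_zero (Finset.mem_univ c) (hw _ _ _ _ _ _ hjc))).symm
      · rfl
      · rfl
  refine Finset.sum_congr rfl fun v _ => ?_
  simp only [hterm, prod_rowSum]
  split_ifs <;> simp

theorem eq_false_of_eventually_eq_false {f : ℕ → Bool} {L : ℕ}
    (h : ∀ c, L ≤ c → f c = true → f (c + 1) = true) (hf : ∀ᶠ c in Filter.atTop, f c = false) :
    ∀ c, L ≤ c → f c = false := by
  intro c hc
  by_contra hfc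
  have h1 : ∀ n, f (c + n) = true := fun n => by
    induction n with
    | zero => simpa using hfc
    | succ n ih => exact h _ (hc.trans (Nat.le_add_right c n)) ih
  obtain ⟨m, hm⟩ := Filter.eventually_atTop.1 hf
  have h2 := hm (c + m) (by omega)
  rw [h1] at h2
  exact absurd h2 (by simp)

/-- Descending from the top: if nothing leaves a row upwards beyond `L`, a path there can never turn
and would stay in the row forever. So the row is empty there, and then nothing can enter it from
below. -/
theorem Configuration.IsAdmissible.far_false {k : ℕ} {C : Configuration k} {bottom top : Set ℕ}
    (h : C.IsAdmissible bottom top false) {L : ℕ} (htop : ∀ c ∈ top, c < L) (c : ℕ) (hc : L ≤ c) :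
    (∀ j, C.vert j c = false) ∧ ∀ j, C.horiz j c = false := by
  have hrow : ∀ j : Fin k, (∀ c, L ≤ c → C.vert j.succ c = false) →
      ∀ c, L ≤ c → C.horiz j c = false := by
    intro j hj
    refine eq_false_of_eventually_eq_false (fun c hc hh => ?_) (h.right_eq j)
    have h1 := h.preserved j c
    rw [hj c hc, hh] at h1
    cases h2 : C.horiz j (c + 1)
    · simp [h2] at h1
    · rfl
  have hvert : ∀ j, ∀ c, L ≤ c → C.vert j c = false := by
    intro j
    induction j using Fin.reverseInduction with
    | last =>
      intro c hc
      by_contra hv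
      exact absurd (htop c ((h.top_iff c).1 (by simpa using hv))) (by omega)
    | cast j ih =>
      intro c hc
      have h1 := h.preserved j c
      rw [ih c hc, hrow j ih c hc, hrow j ih (c + 1) (by omega)] at h1
      cases h2 : C.vert j.castSucc c
      · rfl
      · simp [h2] at h1
  exact ⟨fun j => hvert j c hc, fun j => hrow j (hvert _) c hc⟩

/-- The particle-hole dual of `far_false`, ascending from the bottom: with nothing entering from
below beyond `L`, an empty horizontal edge stays empty forever. -/
theorem Configuration.IsAdmissible.far_true {k : ℕ} {C : Configuration k} {bottom top : Set ℕ}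
    (h : C.IsAdmissible bottom top true) {L : ℕ} (hbottom : ∀ c ∈ bottom, c < L) (c : ℕ)
    (hc : L ≤ c) :
    (∀ j, C.vert j c = false) ∧ ∀ j, C.horiz j c = true := by
  have hrow : ∀ j : Fin k, (∀ c, L ≤ c → C.vert j.castSucc c = false) →
      ∀ c, L ≤ c → C.horiz j c = true := by
    intro j hj c hc
    have h0 := eq_false_of_eventually_eq_false (f := fun c => !C.horiz j c) (L := L)
      (fun c hc hh => ?_) ((h.right_eq j).mono fun c hc => by simp [hc]) c hc
    · simpa using h0
    · have h1 := h.preserved j c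
      rw [hj c hc] at h1
      simp only [Bool.not_eq_true'] at hh ⊢
      rw [hh] at h1
      cases h2 : C.horiz j (c + 1)
      · rfl
      · simp [h2] at h1
  have hvert : ∀ j, ∀ c, L ≤ c → C.vert j c = false := by
    intro j
    induction j using Fin.induction with
    | zero =>
      intro c hc
      by_contra hv
      exact absurd (hbottom c ((h.bottom_iff c).1 (by simpa using hv))) (by omega)
    | succ j ih =>
      intro c hc
      have h1 := h.preserved j c
      rw [ih c hc, hrow j ih c hc, hrow j ih (c + 1) (by omega)] at h1
      cases h2 : C.vert j.succ c
      · rfl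
      · simp [h2] at h1
  exact ⟨fun j => hvert j c hc, fun j => hrow j (hvert _) c hc⟩

/-- Reflection of a row, together with the exchange of the occupied and empty states of the
horizontal edges. -/
theorem rowSum_reflect {R : Type*} [CommSemiring R] {L : ℕ}
    (ω : Bool → Bool → Bool → Bool → R) (b t : Fin L → Bool) :
    rowSum (fun _ => ω) b t true =
      rowSum (fun _ i h τ h' => ω i (!h') τ (!h)) (fun c => b c.rev) (fun c => t c.rev) true := by
  let e : (Fin (L + 1) → Bool) ≃ (Fin (L + 1) → Bool) :=
    { toFun := fun h c => !h c.rev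
      invFun := fun h c => !h c.rev
      left_inv := fun h => by simp
      right_inv := fun h => by simp }
  unfold rowSum
  rw [← e.sum_comp]
  refine Finset.sum_congr rfl fun h _ => ?_
  simp only [e, Equiv.coe_fn_mk, Fin.rev_zero, Fin.rev_last]
  refine if_congr (by cases h 0 <;> cases h (Fin.last L) <;> simp) ?_ rfl
  rw [← Equiv.prod_comp Fin.revPerm]
  refine Finset.prod_congr rfl fun c _ => ?_
  simp [Fin.rev_castSucc, Fin.rev_succ]

/-! ### Jacobi–Trudi determinants -/

section JacobiTrudi

variable {R : Type*} [CommRing R] {n : ℕ}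

theorem Signature.shifted_zero (i : Fin n) : (Signature.zero n).shifted i = n - 1 - i := by
  simp [Signature.shifted, Signature.zero]

/-- The determinant with the entries `h_{λ_j - j + i}`, where `h_m` are the coefficients
of `K`. -/
noncomputable def jacobiTrudi (l : Signature n) (K : PowerSeries R) : R :=
  (Matrix.of fun i j : Fin n => PowerSeries.coeff (l.shifted j)
    (PowerSeries.X ^ (Signature.zero n).shifted i * K)).det

theorem jacobiTrudi_C_mul (l : Signature n) (a : R) (K : PowerSeries R) :
    jacobiTrudi l (PowerSeries.C a * K) = a ^ n * jacobiTrudi l K := by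
  unfold jacobiTrudi
  have h := Matrix.det_smul (Matrix.of fun i j : Fin n => PowerSeries.coeff (l.shifted j)
    (PowerSeries.X ^ (Signature.zero n).shifted i * K)) a
  rw [Fintype.card_fin] at h
  rw [← h]
  congr 1
  ext i j
  simp [mul_left_comm _ (PowerSeries.C a)]

theorem jacobiTrudi_zero {K : PowerSeries R} (hK : PowerSeries.constantCoeff K = 1) :
    jacobiTrudi (Signature.zero n) K = 1 := by
  unfold jacobiTrudi
  rw [Matrix.det_of_isLowerTriangular]
  · simp [PowerSeries.coeff_X_pow_mul', hK]
  · intro i j hij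
    have hij : i < j := hij
    rw [Matrix.of_apply, PowerSeries.coeff_X_pow_mul', if_neg]
    rw [Signature.shifted_zero, Signature.shifted_zero]
    omega

theorem map_jacobiTrudi {S : Type*} [CommRing S] (φ : R →+* S) (l : Signature n)
    (K : PowerSeries R) : φ (jacobiTrudi l K) = jacobiTrudi l (PowerSeries.map φ K) := by
  unfold jacobiTrudi
  rw [RingHom.map_det]
  congr 1
  ext i j
  simp [PowerSeries.coeff_X_pow_mul', apply_ite φ]

/-- Each `P i` is a polynomial of degree less than `n`, hence a combination of the powers Xⁿ⁻¹, …,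
X⁰ that define the rows of `jacobiTrudi`; the matrix factors accordingly. -/
theorem det_coeff_mul (l : Signature n) {P : Fin n → PowerSeries R}
    (hP : ∀ i m, n ≤ m → PowerSeries.coeff m (P i) = 0) (K : PowerSeries R) :
    (Matrix.of fun i j => PowerSeries.coeff (l.shifted j) (P i * K)).det =
      (Matrix.of fun i k => PowerSeries.coeff ((Signature.zero n).shifted k) (P i)).det *
        jacobiTrudi l K := by
  unfold jacobiTrudi
  rw [← Matrix.det_mul]
  congr 1
  ext i j
  have h : P i = ∑ k : Fin n, PowerSeries.C (PowerSeries.coeff ((Signature.zero n).shifted k)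
      (P i)) * PowerSeries.X ^ (Signature.zero n).shifted k := by
    ext m
    simp only [map_sum, PowerSeries.coeff_C_mul, PowerSeries.coeff_X_pow,
      Signature.shifted_zero]
    by_cases hm : n ≤ m
    · rw [hP i m hm, Finset.sum_eq_zero]
      intro k _
      rw [if_neg (by omega), mul_zero]
    · rw [Finset.sum_eq_single ⟨n - 1 - m, by omega⟩]
      · have h1 : n - 1 - (n - 1 - m) = m := by omega
        simp [h1]
      · intro k _ hk
        rw [if_neg, mul_zero]
        intro h
        apply hk
        ext
        simp only
        omega
      · simp
  rw [Matrix.mul_apply, Matrix.of_apply]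
  conv_lhs => rw [h]
  simp [Finset.sum_mul, mul_assoc]

theorem coeff_prod_linear_eq_zero {ι : Type*} (s : Finset ι) (a b : ι → R) {m : ℕ}
    (hm : s.card < m) :
    PowerSeries.coeff m (∏ i ∈ s, (PowerSeries.C (a i) + PowerSeries.C (b i) * PowerSeries.X)) =
      0 := by
  classical
  induction s using Finset.induction generalizing m with
  | empty =>
    rw [Finset.prod_empty, PowerSeries.coeff_one, if_neg]
    rintro rfl
    simp at hm
  | insert i s hi ih =>
    rw [Finset.card_insert_of_notMem hi] at hm
    obtain ⟨m, rfl⟩ : ∃ m', m = m' + 1 := ⟨m - 1, by omega⟩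
    rw [Finset.prod_insert hi, add_mul, map_add, PowerSeries.coeff_C_mul, mul_assoc,
      PowerSeries.coeff_C_mul, PowerSeries.coeff_succ_X_mul, ih (by omega), ih (by omega)]
    simp

/-- Determinants of coefficients of rational functions with the common denominator
`∏ (1 - tᵢ X)`. -/
theorem det_coeff_eq_mul_jacobiTrudi (l : Signature n) (t c : Fin n → R)
    (a b : Fin n → Fin n → R) {H : Fin n → PowerSeries R}
    (hH : ∀ i, H i = PowerSeries.C (c i) * (geom (t i) * ∏ i' ∈ Finset.univ.erase i,
      ((PowerSeries.C (a i i') + PowerSeries.C (b i i') * PowerSeries.X) * geom (t i')))) :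
    (Matrix.of fun i j => PowerSeries.coeff (l.shifted j) (H i)).det =
      (Matrix.of fun i j => PowerSeries.coeff ((Signature.zero n).shifted j) (H i)).det *
        jacobiTrudi l (∏ i, geom (t i)) := by
  have hH' : ∀ i, H i = (PowerSeries.C (c i) * ∏ i' ∈ Finset.univ.erase i,
      (PowerSeries.C (a i i') + PowerSeries.C (b i i') * PowerSeries.X)) *
        ∏ i', geom (t i') := by
    intro i
    rw [hH, Finset.prod_mul_distrib, ← Finset.mul_prod_erase Finset.univ _ (Finset.mem_univ i)]
    ring
  have hdeg : ∀ i m, n ≤ m → PowerSeries.coeff m (PowerSeries.C (c i) *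
      ∏ i' ∈ Finset.univ.erase i,
        (PowerSeries.C (a i i') + PowerSeries.C (b i i') * PowerSeries.X)) = 0 := by
    intro i m hm
    rw [PowerSeries.coeff_C_mul, coeff_prod_linear_eq_zero, mul_zero]
    rw [Finset.card_erase_of_mem (Finset.mem_univ i), Finset.card_univ, Fintype.card_fin]
    have := i.pos
    omega
  simp only [hH']
  -- The factorization is used for λ and for 0ⁿ; the latter has Jacobi–Trudi determinant 1, so its
  -- left side is the numerator determinant.
  rw [det_coeff_mul l hdeg, det_coeff_mul (Signature.zero n) hdeg, jacobiTrudi_zero, mul_one]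
  simp [map_prod, ← PowerSeries.coeff_zero_eq_constantCoeff_apply]

/-- The alternant consists of coefficients of 1/(1 - tᵢX), brought to the common denominator by
numerators 1 - tᵢ'X. -/
theorem alternant_eq_mul_jacobiTrudi (l : Signature n) (t : Fin n → R) :
    alternant l t = alternant (Signature.zero n) t * jacobiTrudi l (∏ i, geom (t i)) := by
  have h := det_coeff_eq_mul_jacobiTrudi l t (fun _ => 1) (fun _ _ => 1) (fun _ i' => -t i')
    (H := fun i => geom (t i)) (fun i => ?_)
  · simpa [alternant] using h
  · rw [Finset.prod_eq_one, map_one, one_mul, mul_one]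
    intro i' _
    rw [← one_sub_mul_geom (t i')]
    simp [sub_eq_add_neg]

theorem map_geom {S : Type*} [CommRing S] (φ : R →+* S) (t : R) :
    PowerSeries.map φ (geom t) = geom (φ t) := by
  ext
  simp

/-- The Jacobi–Trudi identity. -/
theorem eval_schur (l : Signature n) (t : Fin n → ℂ) :
    MvPolynomial.eval t (schur l) = jacobiTrudi l (∏ i, geom (t i)) := by
  -- The alternant is cancelled at the indeterminates and the variables specialized afterwards,
  -- since it vanishes at coinciding values of `t`.
  have h0 : alternant (Signature.zero n) (MvPolynomial.X (R := ℂ)) ≠ 0 := by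
    intro h
    apply alternant_zero_ne_zero (N := n)
    rw [← coe_alternant, h, MvPolynomial.coe_zero]
  have h1 : schur l = jacobiTrudi l (∏ i, geom (MvPolynomial.X (R := ℂ) i)) :=
    mul_left_cancel₀ h0 ((alternant_zero_mul_schur l).trans (alternant_eq_mul_jacobiTrudi l _))
  rw [h1, map_jacobiTrudi, map_prod]
  simp [map_geom]

theorem coeff_prod_rename (f : Fin n → PowerSeries R) (d : Fin n →₀ ℕ) :
    MvPowerSeries.coeff d (∏ i, MvPowerSeries.rename (Function.Embedding.punit i) (f i)) =
      ∏ i, PowerSeries.coeff (d i) (f i) := by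
  classical
  have hone : ∀ (i : Fin n) (m : ℕ), MvPowerSeries.coeff (Finsupp.single i m)
      (MvPowerSeries.rename (Function.Embedding.punit i) (f i)) = PowerSeries.coeff m (f i) := by
    intro i m
    have h := MvPowerSeries.coeff_embDomain_rename (Function.Embedding.punit i) (f i)
      (Finsupp.single () m)
    rwa [Finsupp.embDomain_single] at h
  -- The factor `i` involves only the variable `i`, so just one splitting of `d` contributes.
  rw [MvPowerSeries.coeff_prod, Finset.sum_eq_single
    (Finsupp.equivFunOnFinite.symm fun i => Finsupp.single i (d i))]
  · simp [hone]
  · intro e he hne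
    rw [Finset.mem_finsuppAntidiag] at he
    by_contra h0
    have hsupp : ∀ i, ∃ m, e i = Finsupp.single i m := by
      intro i
      by_contra! hi
      refine h0 (Finset.prod_eq_zero (Finset.mem_univ i)
        (MvPowerSeries.coeff_rename_eq_zero _ _ ?_))
      rintro ⟨x, hx⟩
      refine hi (x ()) ?_
      rw [← hx]
      conv_lhs => rw [Finsupp.unique_single x, Finsupp.mapDomain_single]
      rfl
    choose m hm using hsupp
    refine hne (Finsupp.ext fun i => ?_)
    have h1 : d i = m i := by
      rw [← he.1, Finsupp.finsetSum_apply]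
      simp [hm, Finsupp.single_apply]
    simp [hm, h1]
  · intro h
    refine absurd ?_ h
    rw [Finset.mem_finsuppAntidiag]
    exact ⟨by simp, Finset.subset_univ _⟩

/-- The Cauchy kernel is ∏ K(tᵢ). Multiplied by the Vandermonde alternant it becomes a determinant
whose row `i` depends on tᵢ alone, so its coefficient at λ + δ is the determinant of the
coefficients. -/
theorem supersymSchur_eq_jacobiTrudi {M : ℕ} (l : Signature n) (a b : Fin M → ℂ) :
    supersymSchur l a b = jacobiTrudi l (∏ j,
      ((1 + PowerSeries.C (b j) * PowerSeries.X) * geom (a j))) := by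
  classical
  rw [(cauchyIdentity_supersymSchur n a b).eq_coeff l]
  set K : PowerSeries ℂ := ∏ j, ((1 + PowerSeries.C (b j) * PowerSeries.X) * geom (a j))
    with hK
  let φ : ∀ _ : Fin n, PowerSeries ℂ →ₐ[ℂ] MvPowerSeries (Fin n) ℂ := fun i =>
    MvPowerSeries.rename (Function.Embedding.punit i)
  have hX : ∀ i, φ i PowerSeries.X = MvPowerSeries.X i := fun i =>
    MvPowerSeries.rename_X _ ()
  have hC : ∀ i (c : ℂ), φ i (PowerSeries.C c) = MvPowerSeries.C c := fun i c =>
    MvPowerSeries.rename_C _ c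
  have hkernel : cauchyKernel n a b = ∏ i, φ i K := by
    unfold cauchyKernel
    refine Finset.prod_congr rfl fun i _ => ?_
    rw [hK, map_prod]
    refine Finset.prod_congr rfl fun j _ => ?_
    have hgeom : φ i (geom (a j)) = (1 - MvPowerSeries.X i * MvPowerSeries.C (a j))⁻¹ := by
      rw [MvPowerSeries.eq_inv_iff_mul_eq_one (by simp)]
      have h := congrArg (φ i) (one_sub_mul_geom (a j))
      rw [map_mul, map_sub, map_mul, map_one, hX, hC] at h
      linear_combination h
    rw [map_mul, hgeom, map_add, map_mul, map_one, hX, hC]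
    ring
  have hdet : alternant (Signature.zero n) MvPowerSeries.X * cauchyKernel n a b =
      (Matrix.of fun i j : Fin n =>
        φ i (PowerSeries.X ^ (Signature.zero n).shifted j * K)).det := by
    rw [hkernel, alternant, mul_comm, ← Matrix.det_mul_column]
    congr 1
    ext i j : 2
    simp [hX, mul_comm]
  rw [hdet, jacobiTrudi, ← Matrix.det_transpose (Matrix.of fun i j : Fin n =>
    PowerSeries.coeff (l.shifted j) _), Matrix.det_apply, Matrix.det_apply, map_sum]
  refine Finset.sum_congr rfl fun σ _ => ?_
  -- Reindexing leaves one factor per variable, as `coeff_prod_rename` requires.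
  have hσ : ∏ i, (Matrix.of fun i j : Fin n =>
      φ i (PowerSeries.X ^ (Signature.zero n).shifted j * K)) (σ i) i =
      ∏ i, φ i (PowerSeries.X ^ (Signature.zero n).shifted (σ⁻¹ i) * K) := by
    rw [← Equiv.prod_comp σ fun i => φ i (PowerSeries.X ^ (Signature.zero n).shifted (σ⁻¹ i) * K)]
    simp
  have hσ' : ∏ i, (Matrix.of fun i j : Fin n => PowerSeries.coeff (l.shifted j)
      (PowerSeries.X ^ (Signature.zero n).shifted i * K)).transpose (σ i) i =
      ∏ i, PowerSeries.coeff (l.shifted i)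
        (PowerSeries.X ^ (Signature.zero n).shifted (σ⁻¹ i) * K) := by
    rw [← Equiv.prod_comp σ fun i => PowerSeries.coeff (l.shifted i)
      (PowerSeries.X ^ (Signature.zero n).shifted (σ⁻¹ i) * K)]
    simp
  rw [hσ, hσ', Units.smul_def, Units.smul_def, map_zsmul, coeff_prod_rename]
  rfl

end JacobiTrudi

/-! ### The partition functions as determinants -/

theorem Signature.shifted_lt {N : ℕ} (l : Signature N) (j : Fin N) :
    l.shifted j < N + ∑ i, l.parts i := by
  have h1 := Finset.single_le_sum (f := l.parts) (fun _ _ => Nat.zero_le _) (Finset.mem_univ j)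
  have h2 := j.isLt
  simp only [Signature.shifted]
  omega

/-- The free fermionic row with the weights `W`, for `y = 1`. -/
noncomputable def rowW (x r s : ℂ) : FermionRow ℂ where
  vert := (s ^ (-2 : ℤ) - r ^ (-2 : ℤ) * x) / (s ^ (-2 : ℤ) - x)
  horiz := (1 - x) / (s ^ (-2 : ℤ) - x)
  turnRight := x * (r ^ (-2 : ℤ) - 1) / (s ^ (-2 : ℤ) - x)
  turnUp := (s ^ (-2 : ℤ) - 1) / (s ^ (-2 : ℤ) - x)

/-- The free fermionic row with the weights `Ŵ` for `y = 1`, after the exchange of the occupied and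
empty states of the horizontal edges. -/
noncomputable def rowWHat (x r s : ℂ) : FermionRow ℂ where
  vert := (r ^ (-2 : ℤ) * x - 1) / (1 - x)
  horiz := (s ^ (-2 : ℤ) - x) / (1 - x)
  turnRight := x * (r ^ (-2 : ℤ) - 1) / (1 - x)
  turnUp := (s ^ (-2 : ℤ) - 1) / (1 - x)

/-- Only the doubly occupied vertex needs a computation: this is the free fermion condition. -/
theorem weightW_eq {x r s : ℂ} (h : s ^ (-2 : ℤ) - x ≠ 0) :
    weightW x 1 r s = (rowW x r s).weight := by
  funext i₁ j₁ i₂ j₂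
  cases i₁ <;> cases j₁ <;> cases i₂ <;> cases j₂ <;>
    simp only [weightW, FermionRow.weight, rowW, mul_one, one_mul]
  generalize s ^ (-2 : ℤ) = S at *
  generalize r ^ (-2 : ℤ) = Q at *
  field_simp
  ring

/-- The exchange makes Ŵ(0,1;0,1) = 1 the vacuum and Ŵ(1,0;1,0) the doubly occupied vertex. -/
theorem weightWHat_eq {x r s : ℂ} (h : x ≠ 1) :
    (fun i h τ h' => weightWHat x 1 r s i (!h') τ (!h)) = (rowWHat x r s).weight := by
  have h' : 1 - x ≠ 0 := sub_ne_zero.2 h.symm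
  funext i₁ j₁ i₂ j₂
  cases i₁ <;> cases j₁ <;> cases i₂ <;> cases j₂ <;>
    simp only [weightWHat, FermionRow.weight, rowWHat, mul_one, one_mul, Bool.not_true,
      Bool.not_false]
  field_simp
  ring

theorem weightW_eq_zero {x y r s : ℂ} {i₁ j₁ i₂ j₂ : Bool}
    (h : i₁.toNat + j₁.toNat ≠ i₂.toNat + j₂.toNat) : weightW x y r s i₁ j₁ i₂ j₂ = 0 := by
  cases i₁ <;> cases j₁ <;> cases i₂ <;> cases j₂ <;> simp_all [weightW]

theorem weightWHat_eq_zero {x y r s : ℂ} {i₁ j₁ i₂ j₂ : Bool}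
    (h : i₁.toNat + j₁.toNat ≠ i₂.toNat + j₂.toNat) : weightWHat x y r s i₁ j₁ i₂ j₂ = 0 := by
  cases i₁ <;> cases j₁ <;> cases i₂ <;> cases j₂ <;> simp_all [weightWHat]

theorem Signature.mem_points_zero {N c : ℕ} : c ∈ (Signature.zero N).points ↔ c < N := by
  simp only [Signature.points, Set.mem_range, Signature.shifted_zero]
  constructor
  · rintro ⟨j, rfl⟩
    have := j.isLt
    omega
  · intro hc
    exact ⟨⟨N - 1 - c, by omega⟩, by simp only; omega⟩

theorem G_eq_jacobiTrudi {N M : ℕ} (l : Signature N) (x r : Fin M → ℂ) (s : ℂ)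
    (hx : ∀ j, s ^ (-2 : ℤ) - x j ≠ 0) :
    G l x (fun _ => 1) r (fun _ => s) =
      jacobiTrudi l (∏ j, (rowW (x j) (r j) s).series) := by
  classical
  set L := N + ∑ i, l.parts i with hL
  have hlL : ∀ c ∈ l.points, c < L := by
    rintro _ ⟨j, rfl⟩
    exact l.shifted_lt j
  have h0L : ∀ c ∈ (Signature.zero N).points, c < L := fun c hc => by
    rw [Signature.mem_points_zero] at hc
    omega
  unfold G
  rw [partitionFunction_eq_sum (L := L)
    (b := fun c => decide ((c : ℕ) ∈ (Signature.zero N).points))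
    (t := fun c => decide ((c : ℕ) ∈ l.points))
    (fun c j _ _ _ _ h => weightW_eq_zero h) (fun _ _ => rfl)
    (fun C hC => hC.far_false hlL) h0L hlL (fun c => by simp) (fun c => by simp)]
  simp only [weightW_eq (hx _)]
  have hf : StrictMono (Fin.castLE (show N ≤ L by omega)) := Fin.strictMono_castLE _
  rw [sum_prod_rowSum_eq_topForm _ hf]
  · have hg : StrictMono fun i : Fin N => (⟨l.shifted i.rev, l.shifted_lt _⟩ : Fin L) :=
      fun i j hij => l.shifted_strictAnti (Fin.rev_lt_rev.2 hij)
    rw [wedge_eq_ιMulti hg]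
    · have h1 : ∀ (k : ℕ), (List.ofFn fun _ : Fin k =>
          (1 : ExteriorAlgebra ℂ (Fin N → ℂ))).reverse.prod = 1 := fun k => by simp
      simp only [wedgeFactor, Bool.false_eq_true, if_false, h1, mul_one]
      -- `shifted` decreases while wedge products are taken in increasing order; reversing rows and
      -- columns together costs no sign.
      rw [topForm_ιMulti, jacobiTrudi, ← Matrix.det_transpose,
        ← Matrix.det_submatrix_equiv_self Fin.revPerm (Matrix.of fun i j : Fin N => _)]
      congr 1
      ext i j
      have h2 : N - 1 - (i.rev : ℕ) = i := by
        rw [Fin.val_rev]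
        omega
      simp [Signature.shifted_zero, mul_comm, -Fin.val_rev, h2]
    · intro c
      simp only [decide_eq_true_eq, Signature.points, Set.mem_range]
      constructor
      · rintro ⟨j, hj⟩
        exact ⟨j.rev, Fin.ext (by simpa using hj)⟩
      · rintro ⟨j, rfl⟩
        exact ⟨j.rev, rfl⟩
  · intro c
    simp only [decide_eq_true_eq, Signature.mem_points_zero, Set.mem_range]
    constructor
    · intro hc
      exact ⟨⟨c, hc⟩, rfl⟩
    · rintro ⟨j, rfl⟩
      exact j.isLt

/-- The generating function, over the column of entry, of the weights of the paths which leave the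
free fermionic rows `0, …, j` through the side of the row `j`. -/
noncomputable def sideSeries {R : Type*} [CommRing R] {k : ℕ} (p : Fin k → FermionRow R)
    (j : Fin k) : PowerSeries R :=
  PowerSeries.C (p j).turnRight * (geom (p j).horiz * ∏ i ∈ Finset.Iio j, (p i).series)

theorem reverse_ofFn {α : Type*} {k : ℕ} (f : Fin k → α) :
    (List.ofFn f).reverse = List.ofFn fun i => f i.rev := by
  refine List.ext_getElem (by simp) fun i h1 h2 => ?_
  simp only [List.getElem_reverse, List.getElem_ofFn, List.length_ofFn]
  congr 1
  ext
  simp only [Fin.val_rev]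
  omega

/-- After reflection and particle-hole exchange the top is empty and each row emits one path at its
side, so only the side factors remain. They are multiplied from the top row down, whence the sign of
the reversal. -/
theorem F_eq_det {N : ℕ} (l : Signature N) (x r : Fin N → ℂ) (s : ℂ) (hx : ∀ i, x i ≠ 1) :
    F l x (fun _ => 1) r (fun _ => s) = (Equiv.Perm.sign (Fin.revPerm (n := N)) : ℤ) *
      (Matrix.of fun i j => PowerSeries.coeff (l.shifted j)
        (sideSeries (fun i => rowWHat (x i) (r i) s) i)).det := by
  classical
  set L := N + ∑ i, l.parts i with hL
  have hlL : ∀ c ∈ l.points, c < L := by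
    rintro _ ⟨j, rfl⟩
    exact l.shifted_lt j
  unfold F
  rw [partitionFunction_eq_sum (L := L)
    (b := fun c => decide ((c : ℕ) ∈ l.points)) (t := fun _ => false)
    (fun c j _ _ _ _ h => weightWHat_eq_zero h) (fun _ _ => rfl)
    (fun C hC => hC.far_true hlL) hlL (fun _ h => absurd h (Set.notMem_empty _))
    (fun c => by simp) (fun c => by simp)]
  have hreflect : ∀ j (b t : Fin L → Bool),
      rowSum (fun _ => weightWHat (x j) 1 (r j) s) b t true =
        rowSum (fun _ => (rowWHat (x j) (r j) s).weight) (fun c => b c.rev) (fun c => t c.rev)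
          true := fun j b t => by
    rw [rowSum_reflect, weightWHat_eq (hx j)]
  simp only [hreflect]
  let e : (Fin (N + 1) → Fin L → Bool) ≃ (Fin (N + 1) → Fin L → Bool) :=
    { toFun := fun v j c => v j c.rev
      invFun := fun v j c => v j c.rev
      left_inv := fun v => by simp
      right_inv := fun v => by simp }
  have hf : StrictMono fun i : Fin N => (⟨l.shifted i, l.shifted_lt _⟩ : Fin L).rev :=
    fun i j hij => Fin.rev_lt_rev.2 (l.shifted_strictAnti hij)
  have hsum := sum_prod_rowSum_eq_topForm (fun i => rowWHat (x i) (r i) s) hf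
    (b := fun c => decide ((c.rev : ℕ) ∈ l.points)) (fun c => by
      simp only [decide_eq_true_eq, Signature.points, Set.mem_range]
      constructor
      · rintro ⟨j, hj⟩
        exact ⟨j, by rw [← Fin.rev_rev c]; exact congrArg Fin.rev (Fin.ext hj)⟩
      · rintro ⟨j, rfl⟩
        exact ⟨j, by rw [Fin.rev_rev]⟩) (fun _ => false) true
  rw [← e.sum_comp] at hsum
  refine Eq.trans (Finset.sum_congr rfl fun v _ => if_congr ?_ rfl rfl) (hsum.trans ?_)
  · simp only [e, Equiv.coe_fn_mk]
    refine and_congr ⟨fun h => ?_, fun h => ?_⟩ ⟨fun h => ?_, fun h => ?_⟩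
    · simp [h]
    · ext c
      simpa using congrFun h c.rev
    · simp [h]
    · ext c
      simpa using congrFun h c.rev
  · have h1 : ∀ u : ℕ → Fin N → ℂ, wedge ℂ u (fun _ : Fin L => false) = 1 := fun u => by
      simp [wedge, wedgeFactor]
    rw [h1, one_mul, reverse_ofFn]
    simp only [wedgeFactor, if_true]
    have h2 := ExteriorAlgebra.ιMulti_apply (R := ℂ) (n := N) (fun (j : Fin N) (i : Fin N) =>
      PowerSeries.coeff L ((rowWHat (x j.rev) (r j.rev) s).exitSeries *
        (∏ j' ∈ Finset.Iio j.rev, (rowWHat (x j') (r j') s).series) *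
        PowerSeries.X ^ ((⟨l.shifted i, l.shifted_lt _⟩ : Fin L).rev : ℕ)))
    rw [← h2, topForm_ιMulti, ← Matrix.det_permute]
    congr 1
    ext i j
    have h3 := l.shifted_lt j
    -- The reflected starting column is L - 1 - `l.shifted j`; the extra 1 is absorbed by the factor
    -- X of `exitSeries`.
    have h4 : L - (L - (l.shifted j + 1)) = l.shifted j + 1 := by omega
    simp only [Matrix.of_apply, Matrix.submatrix_apply, Fin.revPerm_apply, id, Fin.val_rev,
      sideSeries, FermionRow.exitSeries]
    rw [PowerSeries.coeff_mul_X_pow', if_pos (by omega), h4, mul_assoc, mul_assoc,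
      PowerSeries.coeff_C_mul, PowerSeries.coeff_C_mul, PowerSeries.coeff_succ_X_mul]

/-! ### Two evaluations of the determinant of side series -/

section Determinants

variable {R : Type*} [CommRing R] {n : ℕ}

theorem FermionRow.series_eq (p : FermionRow R) :
    p.series = (PowerSeries.C p.vert + PowerSeries.C (p.turnRight * p.turnUp - p.vert * p.horiz) *
      PowerSeries.X) * geom p.horiz := by
  simp only [FermionRow.series, map_sub, map_mul]
  linear_combination (-PowerSeries.C p.vert) * one_sub_mul_geom p.horiz

/-- Rows `i' < i` contribute a linear polynomial over 1 - hX by `series_eq`; the remaining ones are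
inserted as 1 = (1 - hX)/(1 - hX). All entries thus share one denominator. -/
theorem det_coeff_sideSeries (l : Signature n) (p : Fin n → FermionRow R) :
    (Matrix.of fun i j => PowerSeries.coeff (l.shifted j) (sideSeries p i)).det =
      (Matrix.of fun i j => PowerSeries.coeff ((Signature.zero n).shifted j)
        (sideSeries p i)).det * jacobiTrudi l (∏ i, geom (p i).horiz) := by
  refine det_coeff_eq_mul_jacobiTrudi l (fun i => (p i).horiz) (fun i => (p i).turnRight)
    (fun i i' => if i' < i then (p i').vert else 1)
    (fun i i' => if i' < i then (p i').turnRight * (p i').turnUp - (p i').vert * (p i').horiz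
      else -(p i').horiz) fun i => ?_
  unfold sideSeries
  congr 2
  have h : Finset.Iio i = (Finset.univ.erase i).filter (· < i) := by
    ext i'
    simp only [Finset.mem_Iio, Finset.mem_filter, Finset.mem_erase, Finset.mem_univ, and_true]
    exact ⟨fun h => ⟨h.ne, h⟩, fun h => h.2⟩
  rw [h, Finset.prod_filter]
  refine Finset.prod_congr rfl fun i' _ => ?_
  split_ifs
  · exact (p i').series_eq
  · rw [← one_sub_mul_geom (p i').horiz]
    simp [sub_eq_add_neg]

/-- Partial fractions, with the denominator b - a cleared. -/
theorem sub_mul_X_mul_geom_mul_geom (a b : R) :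
    (PowerSeries.C b - PowerSeries.C a) * (PowerSeries.X * geom a * geom b) =
      geom b - geom a := by
  linear_combination geom b * one_sub_mul_geom a - geom a * one_sub_mul_geom b

/-- A row acts on a geometric series, up to a multiple of its own geometric series, by a scalar. -/
theorem FermionRow.series_mul_geom (p : FermionRow R) {b κ : R}
    (h : p.turnUp * p.turnRight = κ * (b - p.horiz)) :
    p.series * geom b = (p.vert + κ) • geom b - κ • geom p.horiz := by
  simp only [FermionRow.series, h, PowerSeries.smul_eq_C_mul, map_add, map_mul, map_sub]
  linear_combination PowerSeries.C κ * sub_mul_X_mul_geom_mul_geom p.horiz b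

/-- Each row rescales a foreign geometric series and adds a multiple of its own, so the rows in `S`
act triangularly. -/
theorem prod_series_mul_geom_sub_mem (p : Fin n → FermionRow R) (κ : Fin n → Fin n → R)
    (hκ : ∀ i j, i ≠ j → (p i).turnUp * (p i).turnRight =
      κ i j * ((p j).horiz - (p i).horiz)) (j : Fin n) (S : Finset (Fin n)) (hj : j ∉ S) :
    (∏ i ∈ S, (p i).series) * geom (p j).horiz -
        (∏ i ∈ S, ((p i).vert + κ i j)) • geom (p j).horiz ∈
      Submodule.span R ((fun i => geom (p i).horiz) '' (S : Set (Fin n))) := by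
  induction S using Finset.induction with
  | empty => simp
  | insert a S ha ih =>
    rw [Finset.mem_insert, not_or] at hj
    specialize ih hj.2
    set W := Submodule.span R ((fun i => geom (p i).horiz) '' ((insert a S : Finset _) : Set _))
      with hW
    have hmem : ∀ i ∈ insert a S, geom (p i).horiz ∈ W := fun i hi =>
      Submodule.subset_span ⟨i, by exact_mod_cast hi, rfl⟩
    have hstable : ∀ f ∈ Submodule.span R ((fun i => geom (p i).horiz) '' (S : Set (Fin n))),
        (p a).series * f ∈ W := by
      intro f hf
      induction hf using Submodule.span_induction with
      | mem f hf =>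
        obtain ⟨i, hi, rfl⟩ := hf
        have hi : i ∈ S := by exact_mod_cast hi
        have hai : a ≠ i := fun h => ha (h ▸ hi)
        simp only
        rw [(p a).series_mul_geom (hκ a i hai)]
        exact W.sub_mem (W.smul_mem _ (hmem i (Finset.mem_insert_of_mem hi)))
          (W.smul_mem _ (hmem a (Finset.mem_insert_self _ _)))
      | zero => simp
      | add f g _ _ hf hg =>
        rw [mul_add]
        exact W.add_mem hf hg
      | smul c f _ hf =>
        rw [mul_smul_comm]
        exact W.smul_mem _ hf
    have h1 := hstable _ ih
    -- This multiple of the row's own geometric series arises when row `a` acts on the leading term.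
    have h2 := W.smul_mem (-(∏ i ∈ S, ((p i).vert + κ i j)) * κ a j)
      (hmem a (Finset.mem_insert_self _ _))
    have h3 := W.add_mem h1 h2
    convert! h3 using 1
    have h4 := (p a).series_mul_geom (hκ a j (Ne.symm hj.1))
    rw [Finset.prod_insert ha, Finset.prod_insert ha, mul_sub, mul_smul_comm, h4]
    simp only [smul_sub, smul_smul, neg_mul, neg_smul]
    rw [mul_comm ((p a).vert + κ a j), mul_assoc]
    abel

/-- The expansion coefficients form a lower triangular matrix `T`, whose diagonal gives the product;
the coefficients of the geometric series form the alternant. -/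
theorem det_coeff_sideSeries_eq_alternant (l : Signature n) (p : Fin n → FermionRow R)
    (κ : Fin n → Fin n → R) (hκ : ∀ i j, i ≠ j → (p i).turnUp * (p i).turnRight =
      κ i j * ((p j).horiz - (p i).horiz)) :
    (Matrix.of fun i j => PowerSeries.coeff (l.shifted j) (sideSeries p i)).det =
      (∏ j, ((p j).turnRight * ∏ i ∈ Finset.Iio j, ((p i).vert + κ i j))) *
        alternant l fun i => (p i).horiz := by
  have hspan := fun j => (Submodule.mem_span_image_finset_iff_exists_fun' R).1
    (prod_series_mul_geom_sub_mem p κ hκ j (Finset.Iio j) (by simp))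
  choose c hc using hspan
  let T : Matrix (Fin n) (Fin n) R := Matrix.of fun j i =>
    (p j).turnRight * (if i < j then c j i else if i = j then
      ∏ i ∈ Finset.Iio j, ((p i).vert + κ i j) else 0)
  have hT : T.det = ∏ j, ((p j).turnRight * ∏ i ∈ Finset.Iio j, ((p i).vert + κ i j)) := by
    rw [Matrix.det_of_isLowerTriangular]
    · simp [T]
    · intro i j hij
      have hij : i < j := hij
      simp [T, hij.not_gt, hij.ne']
  rw [← hT, alternant, ← Matrix.det_mul]
  congr 1
  ext j m
  have h1 : (∏ i ∈ Finset.Iio j, (p i).series) * geom (p j).horiz =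
      ∑ i ∈ Finset.Iio j, c j i • geom (p i).horiz +
        (∏ i ∈ Finset.Iio j, ((p i).vert + κ i j)) • geom (p j).horiz := by
    rw [hc]
    abel
  have h2 : ∀ i, (if i < j then c j i else if i = j then
      ∏ i ∈ Finset.Iio j, ((p i).vert + κ i j) else 0) = (if i < j then c j i else 0) +
        if i = j then ∏ i ∈ Finset.Iio j, ((p i).vert + κ i j) else 0 := by
    intro i
    by_cases h : i < j
    · simp [h, h.ne]
    · simp [h]
  have h3 : Finset.Iio j = Finset.univ.filter (· < j) := by
    ext
    simp
  rw [Matrix.of_apply, sideSeries, mul_comm (geom _), h1, Matrix.mul_apply]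
  simp only [T, Matrix.of_apply, h2, mul_assoc, ← Finset.mul_sum, add_mul, Finset.sum_add_distrib,
    ite_mul, zero_mul, Finset.sum_ite_eq', Finset.mem_univ, if_true, PowerSeries.coeff_C_mul,
    map_add, map_sum, map_smul, coeff_geom, smul_eq_mul]
  rw [← Finset.sum_filter, ← h3]

end Determinants

/-! ### Explicit formulas in the parameters of the model -/

theorem sign_revPerm (n : ℕ) :
    ((Equiv.Perm.sign (Fin.revPerm (n := n)) : ℤ) : ℂ) = ∏ i : Fin n, ∏ _j ∈ Finset.Ioi i, -1 := by
  rw [Equiv.Perm.sign_eq_prod_prod_Ioi]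
  push_cast
  refine Finset.prod_congr rfl fun i _ => Finset.prod_congr rfl fun j hj => ?_
  have h : ¬ i.rev < j.rev := by simpa using (Finset.mem_Ioi.1 hj).le
  simp [h]

theorem F_eq_of_injective {N : ℕ} (l : Signature N) {x : Fin N → ℂ} (r : Fin N → ℂ) (s : ℂ)
    (hx : ∀ i, x i ≠ 1) (hinj : Function.Injective x) :
    F l x (fun _ => 1) r (fun _ => s) =
      alternant l (fun i => (s ^ (-2 : ℤ) - x i) / (1 - x i)) *
        (∏ i, (r i ^ (-2 : ℤ) - 1) * x i / (1 - x i)) *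
        ∏ i, ∏ j ∈ Finset.Ioi i, (r i ^ (-2 : ℤ) * x i - x j) / (x i - x j) := by
  have h1 : ∀ i, 1 - x i ≠ 0 := fun i => sub_ne_zero.2 (hx i).symm
  have hne : ∀ i j, i ≠ j → x j - x i ≠ 0 := fun i j hij =>
    sub_ne_zero.2 fun h => hij (hinj h.symm)
  -- κ is the quotient of `turnUp * turnRight` by the difference of the `horiz`; the common factor
  -- s⁻² - 1 is already cancelled, so s² = 1 needs no separate treatment.
  rw [F_eq_det l x r s hx, det_coeff_sideSeries_eq_alternant l _
    (fun i j => x i * (r i ^ (-2 : ℤ) - 1) * (1 - x j) / ((x j - x i) * (1 - x i)))]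
  · rw [Finset.prod_mul_distrib, sign_revPerm]
    have h2 : ∏ j : Fin N, ∏ i ∈ Finset.Iio j, ((rowWHat (x i) (r i) s).vert +
        x i * (r i ^ (-2 : ℤ) - 1) * (1 - x j) / ((x j - x i) * (1 - x i))) =
        ∏ i : Fin N, ∏ j ∈ Finset.Ioi i, (r i ^ (-2 : ℤ) * x i - x j) / (x j - x i) := by
      rw [Finset.prod_comm' (t' := Finset.univ) (s' := fun i => Finset.Ioi i) (by simp)]
      refine Finset.prod_congr rfl fun i _ => Finset.prod_congr rfl fun j hj => ?_
      have h3 := hne i j (Finset.mem_Ioi.1 hj).ne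
      have h4 := h1 i
      simp only [rowWHat]
      generalize r i ^ (-2 : ℤ) = Q
      field_simp
      ring
    -- The sign of the reversal, one -1 per pair, turns x j - x i into x i - x j.
    have h5 : ∏ i : Fin N, ∏ j ∈ Finset.Ioi i, (r i ^ (-2 : ℤ) * x i - x j) / (x i - x j) =
        (∏ i : Fin N, ∏ _j ∈ Finset.Ioi i, (-1 : ℂ)) *
        ∏ i : Fin N, ∏ j ∈ Finset.Ioi i, (r i ^ (-2 : ℤ) * x i - x j) / (x j - x i) := by
      simp only [← Finset.prod_mul_distrib]
      refine Finset.prod_congr rfl fun i _ => Finset.prod_congr rfl fun j _ => ?_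
      rw [← neg_sub (x j) (x i), div_neg]
      ring
    have h6 : ∏ i, (rowWHat (x i) (r i) s).turnRight =
        ∏ i, (r i ^ (-2 : ℤ) - 1) * x i / (1 - x i) :=
      Finset.prod_congr rfl fun i _ => by simp only [rowWHat, mul_comm]
    rw [h2, h5, h6]
    simp only [rowWHat]
    ring
  · intro i j hij
    have h3 := hne i j hij
    have h4 := h1 i
    have h5 := h1 j
    simp only [rowWHat]
    generalize r i ^ (-2 : ℤ) = Q
    generalize s ^ (-2 : ℤ) = S
    field_simp
    ring

theorem F_eq_F_zero_mul {N : ℕ} (l : Signature N) {x : Fin N → ℂ} (r : Fin N → ℂ) (s : ℂ)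
    (hx : ∀ i, x i ≠ 1) :
    F l x (fun _ => 1) r (fun _ => s) = F (Signature.zero N) x (fun _ => 1) r (fun _ => s) *
      MvPolynomial.eval (fun i => (s ^ (-2 : ℤ) - x i) / (1 - x i)) (schur l) := by
  rw [F_eq_det l x r s hx, F_eq_det _ x r s hx, det_coeff_sideSeries, eval_schur, mul_assoc]
  rfl

theorem G_eq_supersymSchur_mul {N M : ℕ} (l : Signature N) {x r : Fin M → ℂ} {s : ℂ}
    (hx : ∀ j, s ^ (-2 : ℤ) - x j ≠ 0) (hr : ∀ j, s ^ (-2 : ℤ) - r j ^ (-2 : ℤ) * x j ≠ 0) :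
    G l x (fun _ => 1) r (fun _ => s) =
      supersymSchur l (fun j => (1 - x j) / (s ^ (-2 : ℤ) - x j))
        (fun j => (x j * r j ^ (-2 : ℤ) - 1) / (s ^ (-2 : ℤ) - r j ^ (-2 : ℤ) * x j)) *
      ∏ i, ((s ^ (-2 : ℤ) - r i ^ (-2 : ℤ) * x i) / (s ^ (-2 : ℤ) - x i)) ^ N := by
  rw [G_eq_jacobiTrudi l x r s hx, supersymSchur_eq_jacobiTrudi, Finset.prod_pow, mul_comm,
    ← jacobiTrudi_C_mul, map_prod, ← Finset.prod_mul_distrib]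
  congr 1
  refine Finset.prod_congr rfl fun j _ => ?_
  -- The doubly occupied weight is the vertical weight times the dual parameter b, so the series is
  -- `vert` times (1 + bX)/(1 - aX).
  have h : (rowW (x j) (r j) s).turnRight * (rowW (x j) (r j) s).turnUp -
      (rowW (x j) (r j) s).vert * (rowW (x j) (r j) s).horiz =
      (s ^ (-2 : ℤ) - r j ^ (-2 : ℤ) * x j) / (s ^ (-2 : ℤ) - x j) *
        ((x j * r j ^ (-2 : ℤ) - 1) / (s ^ (-2 : ℤ) - r j ^ (-2 : ℤ) * x j)) := by
    have h1 := hx j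
    have h2 := hr j
    simp only [rowW]
    generalize r j ^ (-2 : ℤ) = Q at h2 ⊢
    generalize s ^ (-2 : ℤ) = S at h1 h2 ⊢
    rw [mul_comm Q] at h2 ⊢
    field_simp
    ring
  rw [FermionRow.series_eq, h, map_mul]
  simp only [rowW]
  ring

end FreeFermion

theorem proposition4p5 {N : ℕ} (l : Signature N) (s : ℂ) (hs : s ≠ 0) :
    (∀ x r : Fin N → ℂ, (∀ i, r i ≠ 0) → (∀ i, x i ≠ 1) → Function.Injective x →
      F l x (fun _ => 1) r (fun _ => s) =
        (Matrix.of fun i j : Fin N =>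
          ((1 - s ^ 2 * x i) / (s ^ 2 * (1 - x i))) ^ (l.parts j + (N - 1 - (j : ℕ)))).det *
        (∏ i, (r i ^ (-2 : ℤ) - 1) * x i / (1 - x i)) *
        ∏ i, ∏ j ∈ Finset.Ioi i, (r i ^ (-2 : ℤ) * x i - x j) / (x i - x j)) ∧
    (∀ x r : Fin N → ℂ, (∀ i, r i ≠ 0) → (∀ i, x i ≠ 1) →
      F (Signature.zero N) x (fun _ => 1) r (fun _ => s) ≠ 0 →
      F l x (fun _ => 1) r (fun _ => s) / F (Signature.zero N) x (fun _ => 1) r (fun _ => s) =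
        MvPolynomial.eval (fun i => (1 - s ^ 2 * x i) / (s ^ 2 * (1 - x i))) (schur l)) ∧
    (∀ (M : ℕ) (x r : Fin M → ℂ), (∀ j, r j ≠ 0) → (∀ j, 1 - s ^ 2 * x j ≠ 0) →
      (∀ j, 1 - s ^ 2 * r j ^ (-2 : ℤ) * x j ≠ 0) →
      G l x (fun _ => 1) r (fun _ => s) =
        supersymSchur l (fun j => s ^ 2 * (1 - x j) / (1 - s ^ 2 * x j))
          (fun j => s ^ 2 * (x j * r j ^ (-2 : ℤ) - 1) / (1 - s ^ 2 * r j ^ (-2 : ℤ) * x j)) *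
        ∏ i, ((1 - s ^ 2 * r i ^ (-2 : ℤ) * x i) / (1 - s ^ 2 * x i)) ^ N) := by
  have hs2 : s ^ 2 ≠ 0 := pow_ne_zero 2 hs
  -- The lemmas use s⁻² while the statement has denominators cleared by s²; this translates between
  -- them.
  have hdiv : ∀ a : ℂ, s ^ (-2 : ℤ) - a = (1 - s ^ 2 * a) / s ^ 2 := fun a => by
    rw [zpow_neg, zpow_ofNat]
    field_simp
  have hD : ∀ a : ℂ, (1 - s ^ 2 * a) / (s ^ 2 * (1 - a)) = (s ^ (-2 : ℤ) - a) / (1 - a) :=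
    fun a => by rw [hdiv, div_div]
  refine ⟨fun x r _ hx hinj => ?_, fun x r _ hx h0 => ?_, fun M x r _ hx hr => ?_⟩
  · simp only [hD]
    exact F_eq_of_injective l r s hx hinj
  · simp only [hD]
    rw [F_eq_F_zero_mul l r s hx, mul_div_cancel_left₀ _ h0]
  · have hr' : ∀ j, 1 - s ^ 2 * (r j ^ (-2 : ℤ) * x j) ≠ 0 := fun j => by
      rw [← mul_assoc]
      exact hr j
    rw [G_eq_supersymSchur_mul l (fun j => hdiv (x j) ▸ div_ne_zero (hx j) hs2)
      (fun j => hdiv (r j ^ (-2 : ℤ) * x j) ▸ div_ne_zero (hr' j) hs2)]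
    simp only [hdiv, div_div_eq_mul_div, div_mul_cancel₀ _ hs2, ← mul_assoc, mul_comm _ (s ^ 2)]
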